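/- **Setting.** Let $\mathcal X$ be a measurable space, $P$ a probability measure on $\mathcal X\times\{-1,+1\}$ with first marginal $P_X$, and let $Z_i=(X_i,Y_i)$, $i=1,\dots,n$, be independent with law $P$; $\mathbf E$ is the expectation with respect to $P^{\otimes n}$. Let $\eta(x)=\mathbf E(Y_1\mid X_1=x)$. Let $\Phi:\mathbb R\to[0,\infty)$ be convex and twice continuously differentiable. The $\Phi$-risk of a classifier $g:\mathcal X\to\mathbb R$ is $R_\Phi[g]=\int\Phi(-y\,g(x))\,P(dx,dy)$. Let $f=f_\Phi$ be any measurable function such that, for $P_X$-almost every $x$, $f(x)$ minimizes $u\mapsto\Phi(-u)(1+\eta(x))+\Phi(u)(1-\eta(x))$ over $u\in\mathbb R$, and let $\ell_\Phi(g,f)=R_\Phi[g]-R_\Phi[f]$ be the excess $\Phi$-risk. If no such $f$ exists, $R_\Phi[f]$ is replaced by the infimum of $R_\Phi[g]$ over all measurable $g$; the result below holds with this infimum in every case. Let $M\ge2$, let $\phi_1,\dots,\phi_M:\mathcal X\to\mathbb R$ be measurable, and put $f_\lambda=\sum_{j=1}^M\lambda_j\phi_j$, $\|\lambda\|_1=\sum_j|\lambda_j|$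 for $\lambda\in\mathbb R^M$. For $\tau>0$ and $R\ge 2M\tau$, the sparsity prior is the probability measure $$\pi(d\lambda)=\frac1{C_{\tau,R}}\Big\{\prod_{j=1}^M(\tau^2+\lambda_j^2)^{-2}\Big\}\mathbf 1(\|\lambda\|_1\le R)\,d\lambda .$$ For a temperature $\beta>0$, the mirror averaging (MA) aggregate is $$\hat f_n(x)=\frac1{n+1}\sum_{m=0}^n\int f_\lambda(x)\,\hat\theta_{m,\lambda}\,\pi(d\lambda),\qquad \hat\theta_{m,\lambda}=\frac{\exp\{-\frac1\beta\sum_{i=1}^m\Phi(-Y_if_\lambda(X_i))\}}{\int\exp\{-\frac1\beta\sum_{i=1}^m\Phi(-Y_if_w(X_i))\}\,\pi(dw)} .$$ **Proposition 4.** Assume that $\max_{j}\|\phi_j\|_{L^\infty(P_X)}\le L_\phi$ for some constant $L_\phi>0$, and that $$\beta_\Phi:=\sup_{|u|\le RL_\phi}\frac{\Phi'(u)^2}{\Phi''(u)}<\infty$$ (with the conventions $0/0=0$ and $a/0=+\infty$ for $a>0$). Then, for every $\beta\ge\beta_\Phi$, $\beta>0$, the MA aggregate with the sparsity prior satisfies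 $$\mathbf E[\ell_\Phi(\hat f_n,f)]\le\min_{\|\lambda^*\|_1\le R-2M\tau}\Big(\ell_\Phi(f_{\lambda^*},f)+\frac{4\beta}{n+1}\sum_{j=1}^M\log(1+\tau^{-1}|\lambda_j^*|)\Big)+C_\Phi\tau^2\sum_{j=1}^M\|\phi_j\|_{L^2(P_X)}^2+\frac{\beta}{n+1},$$ where $C_\Phi=4\max_{|u|\le RL_\phi}\Phi''(u)$. In particular, the minimum is attained, and $\Phi(-y\hat f_n(x))$ is $P$-integrable for every sample and $\ell_\Phi(\hat f_n,f)$ is $P^{\otimes n}$-integrable. -/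

import Mathlib

open MeasureTheory ProbabilityTheory
open scoped ENNReal

namespace SparsityMA

/-! ### Binary classification and the convex risk -/

/-- The set of labels `{-1, +1}`, as a type with its (discrete) sigma-algebra inherited from `ℝ`. -/
abbrev Label : Type := ({-1, 1} : Set ℝ)

instance : Nonempty Label := ⟨⟨1, by simp⟩⟩

variable {X : Type*}

/-- The regression function `η(x) = E(Y | X = x)`, where `(X, Y) ∼ P`: the mean of the regular
conditional distribution of the label given `X = x`. -/
noncomputable def regressionFunction [MeasurableSpace X] (P : Measure (X × Label))
    [IsFiniteMeasure P] (x : X) : ℝ :=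
  ∫ y, (y : ℝ) ∂(P.condKernel x)

/-- The contrast `Q(z, g) = Φ(-y g(x))`, for `z = (x, y)`. -/
def contrast (Φ : ℝ → ℝ) (z : X × Label) (g : X → ℝ) : ℝ :=
  Φ (-(z.2 : ℝ) * g z.1)

/-- The `Φ`-risk `R_Φ[g] = ∫ Φ(-y g(x)) P(dx, dy)` of a classifier `g`. -/
noncomputable def phiRisk [MeasurableSpace X] (Φ : ℝ → ℝ) (P : Measure (X × Label)) (g : X → ℝ) : ℝ :=
  ∫ z, contrast Φ z g ∂P

/-- `f` is an optimal classifier `f_Φ`: a measurable function such that, for `P_X`-almost every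
`x`, the value `f x` minimizes `u ↦ Φ(-u) (1 + η(x)) + Φ(u) (1 - η(x))` over the real line. -/
def IsPhiOptimal [MeasurableSpace X] (Φ : ℝ → ℝ) (P : Measure (X × Label)) [IsFiniteMeasure P]
    (f : X → ℝ) : Prop :=
  Measurable f ∧ ∀ᵐ x ∂P.fst, IsMinOn
    (fun u : ℝ => Φ (-u) * (1 + regressionFunction P x) + Φ u * (1 - regressionFunction P x))
    Set.univ (f x)

/-- The excess `Φ`-risk `ℓ_Φ(g, f) = R_Φ[g] - R_Φ[f]`. -/
noncomputable def excessPhiRisk [MeasurableSpace X] (Φ : ℝ → ℝ) (P : Measure (X × Label))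
    (g f : X → ℝ) : ℝ :=
  phiRisk Φ P g - phiRisk Φ P f

/-- The smallest possible `Φ`-risk, for a non-negative `Φ`: the infimum, over all measurable
classifiers `g`, of the integral of `Φ(-y g(x))`, infinite values of the integral being allowed.
Evaluated at `g = 0`, the integral is `Φ 0` when `P` is a probability measure, so the infimum is
then finite. -/
noncomputable def infPhiRisk [MeasurableSpace X] (Φ : ℝ → ℝ) (P : Measure (X × Label)) : ℝ :=
  (⨅ (g : X → ℝ) (_ : Measurable g), ∫⁻ z, ENNReal.ofReal (contrast Φ z g) ∂P).toReal

/-- `sup_{|u| ≤ r} Φ'(u)² / Φ''(u)` in `[0, ∞]`. In `ℝ≥0∞` one has `0 / 0 = 0` and `a / 0 = ∞` for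
`a ≠ 0`. -/
noncomputable def betaPhi (Φ : ℝ → ℝ) (r : ℝ) : ℝ≥0∞ :=
  ⨆ u ∈ Set.Icc (-r) r, ENNReal.ofReal (deriv Φ u ^ 2) / ENNReal.ofReal (iteratedDeriv 2 Φ u)

/-- `4 max_{|u| ≤ r} Φ''(u)`. -/
noncomputable def cPhi (Φ : ℝ → ℝ) (r : ℝ) : ℝ :=
  4 * sSup (iteratedDeriv 2 Φ '' Set.Icc (-r) r)

/-! ### The dictionary and the sparsity prior -/

/-- The linear combination `f_λ = ∑ j, λ_j φ_j`. -/
def linComb {M : ℕ} (φ : Fin M → X → ℝ) (l : Fin M → ℝ) (x : X) : ℝ :=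
  ∑ j, l j * φ j x

/-- The ball of radius `r` centred at the origin for the `ℓ¹`-norm of `ℝ^M`. -/
def l1Ball (M : ℕ) (r : ℝ) : Set (Fin M → ℝ) :=
  {l | ∑ j, |l j| ≤ r}

/-- The unnormalized density of the sparsity prior,
`∏ j, (τ² + λ_j²)⁻²` on the `ℓ¹`-ball of radius `R` and `0` elsewhere. -/
noncomputable def sparsityWeight (M : ℕ) (τ R : ℝ) : (Fin M → ℝ) → ℝ :=
  (l1Ball M R).indicator (fun l => ∏ j, ((τ ^ 2 + l j ^ 2) ^ 2)⁻¹)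

/-- The sparsity prior: the measure on `ℝ^M` whose Lebesgue density is the normalized weight. -/
noncomputable def sparsityPrior (M : ℕ) (τ R : ℝ) : Measure (Fin M → ℝ) :=
  volume.withDensity
    (fun l => ENNReal.ofReal (sparsityWeight M τ R l / ∫ w, sparsityWeight M τ R w))

/-! ### The mirror averaging aggregate -/

section Aggregate

variable {Z Λ : Type*} [MeasurableSpace Λ] {n : ℕ}

/-- The exponential weight based on the first `m` observations, as a density with respect to the
prior: `exp(-β⁻¹ ∑_{i ≤ m} Q(Z_i, f_λ)) / ∫ exp(-β⁻¹ ∑_{i ≤ m} Q(Z_i, f_w)) π(dw)`. -/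
noncomputable def expWeight (Q : Z → (X → ℝ) → ℝ) (F : Λ → X → ℝ) (π : Measure Λ) (β : ℝ)
    (m : ℕ) (z : Fin n → Z) (l : Λ) : ℝ :=
  Real.exp (-(1 / β) * ∑ i with i.val < m, Q (z i) (F l)) /
    ∫ w, Real.exp (-(1 / β) * ∑ i with i.val < m, Q (z i) (F w)) ∂π

/-- The average of the `n + 1` exponential weights based on `0, 1, …, n` observations. -/
noncomputable def maWeight (Q : Z → (X → ℝ) → ℝ) (F : Λ → X → ℝ) (π : Measure Λ) (β : ℝ)
    (z : Fin n → Z) (l : Λ) : ℝ :=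
  1 / ((n : ℝ) + 1) * ∑ m ∈ Finset.range (n + 1), expWeight Q F π β m z l

/-- The mirror averaging (MA) aggregate
`f̂_n(z, x) = ∫ f_λ(x) θ̂_λ(z) π(dλ)`. -/
noncomputable def maAggregate (Q : Z → (X → ℝ) → ℝ) (F : Λ → X → ℝ) (π : Measure Λ) (β : ℝ)
    (z : Fin n → Z) (x : X) : ℝ :=
  ∫ l, F l x * maWeight Q F π β z l ∂π

end Aggregate

/-- The MA aggregate for the contrast `Φ(-y g(x))`, the linear combinations of the dictionary `φ`,
the sparsity prior with parameters `τ`, `R` and the temperature `β`. -/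
noncomputable def sparseMA (Φ : ℝ → ℝ) {M n : ℕ} (φ : Fin M → X → ℝ) (τ R β : ℝ)
    (z : Fin n → X × Label) : X → ℝ :=
  maAggregate (contrast Φ) (linComb φ) (sparsityPrior M τ R) β z

end SparsityMA

namespace SparsityMA

/-! The condition on `betaPhi` says that `exp(-Φ/β)` is concave on the range of the margins.
Jensen's inequality under the Gibbs posterior then bounds the loss of a posterior mean at the next
observation by `-β` times an increment of the log-partition function (`loss_integral_gibbs_le`).
Over `n + 1` observations these increments telescope to `-β` times the final log-partition function,
which is at most the cumulative loss under any `ρ ≤ c • π` plus `β log c`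
(`neg_log_integral_exp_le`). A fresh point together with the sample is again an i.i.d. sample, of
size `n + 1`, and convexity of `Φ` passes from the stages to their average
(`integral_loss_mirrorAveraging_le`).

The competitor `ρ` is the sparsity prior of radius `2Mτ` translated to `λ*`. Polynomial tails make
its density with respect to the prior at most `2 ∏ (1 + |λ*_j|/τ)^4` (`map_sparsityPrior_le`), so
`log c` is the logarithmic penalty plus `log 2`. The perturbation is centred with uncorrelated
coordinates of variance at most `2τ²`, hence it raises the risk only by a second-order term in `τ`
(`integral_comp_linear_sparsityPrior_le`).

Subtracting a constant from all risks shifts both sides equally, so one inequality covers recentring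
at `R_Φ[f]` and at the infimum of the risk. -/

/-! ### Mirror averaging for exp-concave losses -/

section MirrorAveraging

variable {Z Λ : Type*} {n : ℕ}

/-- The cumulative loss of the parameter `l` on the first `m` observations. -/
def cumLoss (q : Z → Λ → ℝ) (m : ℕ) (z : Fin n → Z) (l : Λ) : ℝ :=
  ∑ i with i.val < m, q (z i) l

/-- Stage `m` sees only indices below `m`, which keep their place when coordinate `m` is deleted.
Coordinate `m` of a sample of size `n + 1` can thus act as the fresh test point for stage `m`. -/
theorem cumLoss_removeNth (q : Z → Λ → ℝ) (m : Fin (n + 1)) (y : Fin (n + 1) → Z) :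
    cumLoss q m (m.removeNth y) = cumLoss q m y := by
  funext l
  simp only [cumLoss, Finset.sum_filter]
  rw [Fin.sum_univ_succAbove _ m]
  simp only [lt_irrefl, if_false, zero_add]
  refine Finset.sum_congr rfl fun i _ => ?_
  have h : (m.succAbove i).val < m.val ↔ i.val < m.val := by
    rw [← Fin.lt_def, Fin.succAbove_lt_iff_castSucc_lt, Fin.lt_def, Fin.val_castSucc]
  simp only [h, Fin.removeNth]

theorem cumLoss_succ (q : Z → Λ → ℝ) (m : Fin n) (y : Fin n → Z) (l : Λ) :
    cumLoss q (m + 1) y l = cumLoss q m y l + q (y m) l := by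
  have : (Finset.univ.filter fun i : Fin n => i.val < m.val + 1)
      = insert m (Finset.univ.filter fun i : Fin n => i.val < m.val) := by
    ext i
    simp only [Finset.mem_filter, Finset.mem_univ, true_and, Finset.mem_insert, Fin.ext_iff]
    omega
  rw [cumLoss, this, Finset.sum_insert (by simp), add_comm, cumLoss]

theorem cumLoss_nonneg {q : Z → Λ → ℝ} (hq : ∀ z l, 0 ≤ q z l) (m : ℕ) (z : Fin n → Z) (l : Λ) :
    0 ≤ cumLoss q m z l :=
  Finset.sum_nonneg fun _ _ => hq _ _

variable [MeasurableSpace Λ]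

theorem abs_integral_le_of_ae {ν : Measure Λ} [IsProbabilityMeasure ν] {h : Λ → ℝ} {B : ℝ}
    (hb : ∀ᵐ a ∂ν, |h a| ≤ B) : |∫ a, h a ∂ν| ≤ B := by
  simpa using norm_integral_le_of_norm_le_const (μ := ν) (f := h) hb

/-- The Gibbs posterior based on the first `m` observations. -/
noncomputable def gibbs (π : Measure Λ) (β : ℝ) (q : Z → Λ → ℝ) (m : ℕ) (z : Fin n → Z) :
    Measure Λ :=
  π.tilted fun l => -(1 / β) * cumLoss q m z l

/-- The normalizing constant of the Gibbs posterior. -/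
noncomputable def partitionFn (π : Measure Λ) (β : ℝ) (q : Z → Λ → ℝ) (m : ℕ) (z : Fin n → Z) :
    ℝ :=
  ∫ l, Real.exp (-(1 / β) * cumLoss q m z l) ∂π

theorem gibbs_absolutelyContinuous (π : Measure Λ) (β : ℝ) (q : Z → Λ → ℝ) (m : ℕ)
    (z : Fin n → Z) : gibbs π β q m z ≪ π :=
  tilted_absolutelyContinuous _ _

variable [MeasurableSpace Z]

theorem measurable_cumLoss {q : Z → Λ → ℝ} (hq : Measurable (Function.uncurry q)) (m : ℕ) :
    Measurable fun p : (Fin n → Z) × Λ => cumLoss q m p.1 p.2 := by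
  unfold cumLoss
  refine Finset.measurable_sum _ fun i _ => ?_
  exact hq.comp (g := Function.uncurry q) (f := fun p : (Fin n → Z) × Λ => (p.1 i, p.2))
    (((measurable_pi_apply i).comp measurable_fst).prodMk measurable_snd)

theorem integrable_exp_of_nonpos {μ : Measure Λ} [IsFiniteMeasure μ] {f : Λ → ℝ}
    (hf : Measurable f) (h0 : ∀ l, f l ≤ 0) : Integrable (fun l => Real.exp (f l)) μ := by
  refine Integrable.of_bound (C := 1) (Real.measurable_exp.comp hf).aestronglyMeasurable ?_
  refine Filter.Eventually.of_forall fun l => ?_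
  rw [Real.norm_eq_abs, abs_of_pos (Real.exp_pos _)]
  exact Real.exp_le_one_iff.2 (h0 l)

variable {π : Measure Λ} [IsProbabilityMeasure π] {β : ℝ} {q : Z → Λ → ℝ}

theorem integrable_exp_cumLoss (hβ : 0 < β) (hq : Measurable (Function.uncurry q))
    (hq0 : ∀ z l, 0 ≤ q z l) (m : ℕ) (z : Fin n → Z) :
    Integrable (fun l => Real.exp (-(1 / β) * cumLoss q m z l)) π := by
  refine integrable_exp_of_nonpos
    (((measurable_cumLoss hq m).comp measurable_prodMk_left).const_mul _) fun l => ?_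
  have h1 := cumLoss_nonneg hq0 m z l
  have h2 : 0 < 1 / β := by positivity
  nlinarith

theorem partitionFn_pos (hβ : 0 < β) (hq : Measurable (Function.uncurry q))
    (hq0 : ∀ z l, 0 ≤ q z l) (m : ℕ) (z : Fin n → Z) : 0 < partitionFn π β q m z :=
  integral_exp_pos (integrable_exp_cumLoss hβ hq hq0 m z)

theorem isProbabilityMeasure_gibbs (hβ : 0 < β) (hq : Measurable (Function.uncurry q))
    (hq0 : ∀ z l, 0 ≤ q z l) (m : ℕ) (z : Fin n → Z) :
    IsProbabilityMeasure (gibbs π β q m z) :=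
  isProbabilityMeasure_tilted (integrable_exp_cumLoss hβ hq hq0 m z)

/-- Joint measurability in the sample and the test point, needed for Fubini. Unfolding the tilt
leaves parametric integrals against the fixed measure `π`. -/
theorem measurable_integral_gibbs {W : Type*} [MeasurableSpace W] {H : W → Λ → ℝ}
    (hH : Measurable (Function.uncurry H)) (hq : Measurable (Function.uncurry q)) (m : ℕ) :
    Measurable fun p : (Fin n → Z) × W => ∫ l, H p.2 l ∂(gibbs π β q m p.1) := by
  have hE : Measurable fun p : (Fin n → Z) × Λ => Real.exp (-(1 / β) * cumLoss q m p.1 p.2) :=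
    Real.measurable_exp.comp ((measurable_cumLoss hq m).const_mul _)
  have hW : Measurable fun z : Fin n → Z => ∫ l, Real.exp (-(1 / β) * cumLoss q m z l) ∂π :=
    (StronglyMeasurable.integral_prod_right' (ν := π) hE.stronglyMeasurable).measurable
  simp only [gibbs, integral_tilted, smul_eq_mul]
  refine (StronglyMeasurable.integral_prod_right' (ν := π)
    (f := fun p : ((Fin n → Z) × W) × Λ => Real.exp (-(1 / β) * cumLoss q m p.1.1 p.2) /
      (∫ l, Real.exp (-(1 / β) * cumLoss q m p.1.1 l) ∂π) * H p.1.2 p.2) ?_).measurable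
  refine Measurable.stronglyMeasurable ?_
  refine ((hE.comp ((measurable_fst.comp measurable_fst).prodMk measurable_snd)).div
    (hW.comp (measurable_fst.comp measurable_fst))).mul
    (hH.comp ((measurable_snd.comp measurable_fst).prodMk measurable_snd))

/-- Change of measure in the variational formula for the log-partition function. -/
theorem neg_log_integral_exp_le {ρ : Measure Λ} [IsProbabilityMeasure ρ] {c : ℝ} (hc : 0 < c)
    (hρ : ρ ≤ ENNReal.ofReal c • π) (hβ : 0 < β) {S : Λ → ℝ} (hS : Measurable S)
    (hS0 : ∀ l, 0 ≤ S l) (hSi : Integrable S ρ) :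
    -β * Real.log (∫ l, Real.exp (-(1 / β) * S l) ∂π) ≤ ∫ l, S l ∂ρ + β * Real.log c := by
  have hβ' : 0 < 1 / β := by positivity
  have hm : Measurable fun l => -(1 / β) * S l := hS.const_mul _
  have hn : ∀ l, -(1 / β) * S l ≤ 0 := fun l => by nlinarith [hS0 l]
  have hJ : Real.exp (∫ l, -(1 / β) * S l ∂ρ) ≤ ∫ l, Real.exp (-(1 / β) * S l) ∂ρ :=
    convexOn_exp.map_integral_le Real.continuous_exp.continuousOn isClosed_univ (by simp)
      (hSi.const_mul _) (integrable_exp_of_nonpos hm hn)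
  -- The density bound plays the role of the relative entropy of `ρ` with respect to `π`, which is
  -- at most `log c`.
  have hM : ∫ l, Real.exp (-(1 / β) * S l) ∂ρ ≤ c * ∫ l, Real.exp (-(1 / β) * S l) ∂π := by
    have h := integral_mono_measure (f := fun l => Real.exp (-(1 / β) * S l)) hρ
      (Filter.Eventually.of_forall fun l => (Real.exp_pos _).le)
      ((integrable_exp_of_nonpos hm hn).smul_measure ENNReal.ofReal_ne_top)
    rwa [integral_smul_measure, ENNReal.toReal_ofReal hc.le, smul_eq_mul] at h
  have hpos : 0 < ∫ l, Real.exp (-(1 / β) * S l) ∂π :=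
    integral_exp_pos (integrable_exp_of_nonpos hm hn)
  have hlog := Real.log_le_log (Real.exp_pos _) (hJ.trans hM)
  rw [Real.log_exp, Real.log_mul hc.ne' hpos.ne', integral_const_mul] at hlog
  have h3 := mul_le_mul_of_nonneg_left hlog hβ.le
  have h4 : β * (-(1 / β) * ∫ l, S l ∂ρ) = -∫ l, S l ∂ρ := by field_simp
  rw [h4] at h3
  linarith

variable {Φ : ℝ → ℝ} {H : Z → Λ → ℝ} {B : ℝ}

/-- Jensen for the concave function `exp(-Φ/β)` under the posterior. The resulting posterior mean is
a ratio of consecutive partition functions, so taking logarithms produces an increment. -/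
theorem loss_integral_gibbs_le (hβ : 0 < β) (hΦc : Continuous Φ) (hΦ0 : ∀ u, 0 ≤ Φ u)
    (hexp : ConcaveOn ℝ (Set.Icc (-B) B) fun u => Real.exp (-(1 / β) * Φ u))
    (hH : Measurable (Function.uncurry H)) (m : Fin n) (y : Fin n → Z)
    (hy : ∀ᵐ l ∂π, |H (y m) l| ≤ B) :
    Φ (∫ l, H (y m) l ∂(gibbs π β (fun z l => Φ (H z l)) m y)) ≤
      -β * (Real.log (partitionFn π β (fun z l => Φ (H z l)) (m + 1) y)
        - Real.log (partitionFn π β (fun z l => Φ (H z l)) m y)) := by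
  set q : Z → Λ → ℝ := fun z l => Φ (H z l) with hqdef
  have hq : Measurable (Function.uncurry q) := hΦc.measurable.comp hH
  have hq0 : ∀ z l, 0 ≤ q z l := fun z l => hΦ0 _
  have hβ' : 0 < 1 / β := by positivity
  have hHm : Measurable (H (y m)) := hH.comp measurable_prodMk_left
  have : IsProbabilityMeasure (gibbs π β q m y) := isProbabilityMeasure_gibbs hβ hq hq0 m y
  have hy' : ∀ᵐ l ∂(gibbs π β q m y), |H (y m) l| ≤ B :=
    (gibbs_absolutelyContinuous π β q m.val y).ae_le hy
  have hJ := hexp.le_map_integral (μ := gibbs π β q m y) (f := H (y m))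
    (Continuous.continuousOn (by fun_prop)) isClosed_Icc
    (hy'.mono fun l hl => abs_le.1 hl)
    (Integrable.of_bound (C := B) hHm.aestronglyMeasurable hy')
    (integrable_exp_of_nonpos ((hΦc.measurable.comp hHm).const_mul _)
      fun l => by have := hΦ0 (H (y m) l); nlinarith)
  have hE : ∫ l, Real.exp (-(1 / β) * Φ (H (y m) l)) ∂(gibbs π β q m y)
      = partitionFn π β q (m + 1) y / partitionFn π β q m y := by
    rw [gibbs, integral_exp_tilted, partitionFn, partitionFn]
    congr 2
    funext l
    rw [cumLoss_succ, Pi.add_apply, mul_add]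
  rw [hE] at hJ
  have h1 := partitionFn_pos (π := π) hβ hq hq0 (m + 1) y
  have h2 := partitionFn_pos (π := π) hβ hq hq0 m y
  have hlog := Real.log_le_log (div_pos h1 h2) hJ
  rw [Real.log_exp, Real.log_div h1.ne' h2.ne'] at hlog
  have h3 := mul_le_mul_of_nonneg_left hlog hβ.le
  have h4 : ∀ a : ℝ, β * (-(1 / β) * a) = -a := fun a => by field_simp
  rw [h4] at h3
  linarith

/-- Telescoping the one-step bounds leaves only the final log-partition function, to which the
variational bound applies. -/
theorem sum_loss_integral_gibbs_le (hβ : 0 < β) (hΦc : Continuous Φ) (hΦ0 : ∀ u, 0 ≤ Φ u)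
    (hexp : ConcaveOn ℝ (Set.Icc (-B) B) fun u => Real.exp (-(1 / β) * Φ u))
    (hH : Measurable (Function.uncurry H)) (y : Fin n → Z)
    (hy : ∀ i, ∀ᵐ l ∂π, |H (y i) l| ≤ B)
    {ρ : Measure Λ} [IsProbabilityMeasure ρ] {c : ℝ} (hc : 0 < c)
    (hρ : ρ ≤ ENNReal.ofReal c • π) (hint : ∀ i, Integrable (fun l => Φ (H (y i) l)) ρ) :
    ∑ m : Fin n, Φ (∫ l, H (y m) l ∂(gibbs π β (fun z l => Φ (H z l)) m y)) ≤
      ∑ i, ∫ l, Φ (H (y i) l) ∂ρ + β * Real.log c := by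
  set q : Z → Λ → ℝ := fun z l => Φ (H z l) with hqdef
  have hq : Measurable (Function.uncurry q) := hΦc.measurable.comp hH
  have hq0 : ∀ z l, 0 ≤ q z l := fun z l => hΦ0 _
  have hfull : cumLoss q n y = fun l => ∑ i, Φ (H (y i) l) := by
    funext l
    simp [cumLoss, hqdef]
  calc _ ≤ ∑ m : Fin n, -β * (Real.log (partitionFn π β q (m + 1) y)
        - Real.log (partitionFn π β q m y)) :=
        Finset.sum_le_sum fun m _ => loss_integral_gibbs_le hβ hΦc hΦ0 hexp hH m y (hy m)
    _ = -β * Real.log (partitionFn π β q n y) := by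
        rw [← Finset.mul_sum, Fin.sum_univ_eq_sum_range
          (fun m => Real.log (partitionFn π β q (m + 1) y) - Real.log (partitionFn π β q m y)) n,
          Finset.sum_range_sub (fun m => Real.log (partitionFn π β q m y)) n]
        -- The stage-zero term vanishes: the loss is an empty sum and `π` has mass one.
        simp [partitionFn, cumLoss]
    _ ≤ ∫ l, cumLoss q n y l ∂ρ + β * Real.log c := by
        refine neg_log_integral_exp_le hc hρ hβ
          ((measurable_cumLoss hq n).comp measurable_prodMk_left) (cumLoss_nonneg hq0 n y) ?_
        rw [hfull]
        exact integrable_finsetSum _ fun i _ => hint i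
    _ = _ := by
        rw [hfull, integral_finsetSum _ fun i _ => hint i]

/-- The oracle inequality for mirror averaging with an exp-concave convex loss, with an arbitrary
competitor `ρ` whose density with respect to the prior is at most `c`. -/
theorem integral_loss_mirrorAveraging_le {P : Measure Z} [IsProbabilityMeasure P]
    (hβ : 0 < β) (hΦc : Continuous Φ) (hΦ0 : ∀ u, 0 ≤ Φ u) (hΦconv : ConvexOn ℝ Set.univ Φ)
    (hexp : ConcaveOn ℝ (Set.Icc (-B) B) fun u => Real.exp (-(1 / β) * Φ u))
    (hH : Measurable (Function.uncurry H))
    (hHB : ∀ᵐ z ∂P, ∀ᵐ l ∂π, |H z l| ≤ B)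
    {ρ : Measure Λ} [IsProbabilityMeasure ρ] {c : ℝ} (hc : 0 < c)
    (hρ : ρ ≤ ENNReal.ofReal c • π) :
    ∫ z : Fin n → Z, ∫ z', Φ (1 / ((n : ℝ) + 1) * ∑ m ∈ Finset.range (n + 1),
        ∫ l, H z' l ∂(gibbs π β (fun z l => Φ (H z l)) m z)) ∂P ∂(Measure.pi fun _ => P)
      ≤ ∫ z', ∫ l, Φ (H z' l) ∂ρ ∂P + β / ((n : ℝ) + 1) * Real.log c := by
  set q : Z → Λ → ℝ := fun z l => Φ (H z l) with hqdef
  have hq : Measurable (Function.uncurry q) := hΦc.measurable.comp hH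
  have hq0 : ∀ z l, 0 ≤ q z l := fun z l => hΦ0 _
  have hg : ∀ (k : ℕ) (m : ℕ) (z : Fin k → Z), IsProbabilityMeasure (gibbs π β q m z) :=
    fun k m z => isProbabilityMeasure_gibbs hβ hq hq0 m z
  obtain ⟨D, hD⟩ : ∃ D, ∀ u ∈ Set.Icc (-B) B, ‖Φ u‖ ≤ D :=
    isCompact_Icc.exists_bound_of_continuousOn hΦc.continuousOn
  set h : ℕ → (Fin n → Z) × Z → ℝ := fun m p => ∫ l, H p.2 l ∂(gibbs π β q m p.1) with hh
  have hhm : ∀ m, Measurable (h m) := fun m => measurable_integral_gibbs hH hq m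
  -- This holds for every sample `z`, typical or not, because each posterior is absolutely
  -- continuous with respect to `π`.
  have hhB : ∀ m z, ∀ᵐ z' ∂P, |h m (z, z')| ≤ B := fun m z => hHB.mono fun z' hz' =>
    abs_integral_le_of_ae ((gibbs_absolutelyContinuous π β q m z).ae_le hz')
  set Q : Measure (Fin n → Z) := Measure.pi fun _ => P
  have hmem : ∀ x : ℝ, |x| ≤ B → x ∈ Set.Icc (-B) B := fun x hx => abs_le.1 hx
  have hmix : ∀ p, Φ (1 / ((n : ℝ) + 1) * ∑ m ∈ Finset.range (n + 1), h m p)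
      ≤ ∑ m ∈ Finset.range (n + 1), 1 / ((n : ℝ) + 1) * Φ (h m p) := fun p => by
    have := hΦconv.map_sum_le (t := Finset.range (n + 1)) (w := fun _ => 1 / ((n : ℝ) + 1))
      (p := fun m => h m p) (fun _ _ => by positivity) (by simp; field_simp)
      (fun _ _ => Set.mem_univ _)
    simpa only [smul_eq_mul, ← Finset.mul_sum] using this
  -- joint integrability of each loss
  have hint : ∀ m, Integrable (fun p => Φ (h m p)) (Q.prod P) := fun m => by
    refine Integrable.of_bound (C := D) (hΦc.measurable.comp (hhm m)).aestronglyMeasurable ?_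
    have hms : MeasurableSet {p : (Fin n → Z) × Z | ‖Φ (h m p)‖ ≤ D} :=
      measurableSet_le (hΦc.measurable.comp (hhm m)).norm measurable_const
    rw [Measure.ae_prod_iff_ae_ae hms]
    exact Filter.Eventually.of_forall fun z => (hhB m z).mono fun z' hz' => hD _ (hmem _ hz')
  have hintmix : Integrable (fun p : (Fin n → Z) × Z =>
      Φ (1 / ((n : ℝ) + 1) * ∑ m ∈ Finset.range (n + 1), h m p)) (Q.prod P) := by
    refine (integrable_finsetSum (Finset.range (n + 1)) fun m _ =>
      (hint m).const_mul (1 / ((n : ℝ) + 1))).mono'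
      (hΦc.measurable.comp ((Finset.measurable_sum _ fun m _ => hhm m).const_mul
        _)).aestronglyMeasurable ?_
    simp only [Real.norm_eq_abs, abs_of_nonneg (hΦ0 _)]
    exact Filter.Eventually.of_forall hmix
  -- passage to the sample of size `n + 1`
  set Q' : Measure (Fin (n + 1) → Z) := Measure.pi fun _ => P
  -- For each `m`, the pair (sample, fresh point) has the law of an `n + 1` sample split at
  -- coordinate `m`. All stages are thereby evaluated on one common sample, as the telescoping
  -- requires.
  have hmp : ∀ m : Fin (n + 1), MeasurePreserving
      (fun y : Fin (n + 1) → Z => (m.removeNth y, y m)) Q' (Q.prod P) := fun m =>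
    Measure.measurePreserving_swap.comp (measurePreserving_piFinSuccAbove (fun _ => P) m)
  have hkey : ∀ m (y : Fin (n + 1) → Z), h m.val (m.removeNth y, y m)
      = ∫ l, H (y m) l ∂(gibbs π β q m y) := fun m y => by
    simp only [hh, gibbs, cumLoss_removeNth]
  have hint' : ∀ m : Fin (n + 1), Integrable (fun y => Φ (∫ l, H (y m) l ∂(gibbs π β q m y))) Q' :=
    fun m => by
      have := (hmp m).integrable_comp_of_integrable (hint m)
      simpa only [Function.comp_def, hkey] using this
  have heq : ∀ m : Fin (n + 1), ∫ p, Φ (h m.val p) ∂(Q.prod P)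
      = ∫ y, Φ (∫ l, H (y m) l ∂(gibbs π β q m y)) ∂Q' := fun m => by
    rw [← (hmp m).map_eq, integral_map (hmp m).measurable.aemeasurable
      (f := fun p => Φ (h m.val p)) (hΦc.measurable.comp (hhm m)).aestronglyMeasurable]
    simp only [hkey]
  -- the competitor
  have hρπ : ρ ≪ π := (Measure.absolutelyContinuous_of_le hρ).trans
    Measure.smul_absolutelyContinuous
  have hHρ : ∀ᵐ z ∂P, ∀ᵐ l ∂ρ, |H z l| ≤ B := hHB.mono fun z hz => hρπ.ae_le hz
  set G : Z → ℝ := fun z => ∫ l, Φ (H z l) ∂ρ with hG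
  have hGm : Measurable G :=
    (StronglyMeasurable.integral_prod_right' (ν := ρ) hq.stronglyMeasurable).measurable
  have hGi : Integrable G P := Integrable.of_bound (C := D) hGm.aestronglyMeasurable
    (hHρ.mono fun z hz => abs_integral_le_of_ae (hz.mono fun l hl => hD _ (hmem _ hl)))
  have hev : ∀ i : Fin (n + 1), MeasurePreserving (Function.eval i) Q' P := fun i =>
    measurePreserving_eval (fun _ => P) i
  have hGi' : ∀ i, Integrable (fun y : Fin (n + 1) → Z => G (y i)) Q' := fun i =>
    (hev i).integrable_comp_of_integrable hGi
  have hGeq : ∀ i, ∫ y : Fin (n + 1) → Z, G (y i) ∂Q' = ∫ z, G z ∂P := fun i => by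
    conv_rhs => rw [← (hev i).map_eq, integral_map (hev i).measurable.aemeasurable
      hGm.aestronglyMeasurable]
  have hgood : ∀ᵐ y ∂Q', ∀ i, ∀ᵐ l ∂π, |H (y i) l| ≤ B :=
    ae_all_iff.2 fun i => (hev i).quasiMeasurePreserving.ae hHB
  have hbound : ∫ y, ∑ m : Fin (n + 1), Φ (∫ l, H (y m) l ∂(gibbs π β q m y)) ∂Q'
      ≤ ((n : ℝ) + 1) * ∫ z, G z ∂P + β * Real.log c := by
    calc _ ≤ ∫ y, (∑ i : Fin (n + 1), G (y i) + β * Real.log c) ∂Q' := by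
          refine integral_mono_ae (integrable_finsetSum _ fun m _ => hint' m)
            ((integrable_finsetSum _ fun i _ => hGi' i).add (integrable_const _)) ?_
          filter_upwards [hgood] with y hy
          refine sum_loss_integral_gibbs_le hβ hΦc hΦ0 hexp hH y hy hc hρ fun i => ?_
          refine Integrable.of_bound (C := D)
            (hΦc.measurable.comp (hH.comp measurable_prodMk_left)).aestronglyMeasurable ?_
          have hyi : ∀ᵐ l ∂ρ, |H (y i) l| ≤ B := hρπ.ae_le (hy i)
          exact hyi.mono fun l hl => hD _ (hmem _ hl)
      _ = _ := by
          rw [integral_add (integrable_finsetSum _ fun i _ => hGi' i) (integrable_const _),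
            integral_finsetSum _ fun i _ => hGi' i]
          simp [hGeq]
  calc ∫ z : Fin n → Z, ∫ z', Φ (1 / ((n : ℝ) + 1) * ∑ m ∈ Finset.range (n + 1),
        h m (z, z')) ∂P ∂Q
      = ∫ p, Φ (1 / ((n : ℝ) + 1) * ∑ m ∈ Finset.range (n + 1), h m p) ∂(Q.prod P) :=
        (integral_prod _ hintmix).symm
    _ ≤ ∫ p, ∑ m ∈ Finset.range (n + 1), 1 / ((n : ℝ) + 1) * Φ (h m p) ∂(Q.prod P) := by
        exact integral_mono hintmix
          (integrable_finsetSum _ fun m _ => (hint m).const_mul _) hmix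
    _ = 1 / ((n : ℝ) + 1) * ∫ y, ∑ m : Fin (n + 1), Φ (∫ l, H (y m) l ∂(gibbs π β q m y)) ∂Q' := by
        rw [integral_finsetSum _ fun m _ => (hint m).const_mul _,
          integral_finsetSum _ fun m _ => hint' m, Finset.mul_sum,
          ← Fin.sum_univ_eq_sum_range
            (fun m => ∫ p, 1 / ((n : ℝ) + 1) * Φ (h m p) ∂(Q.prod P)) (n + 1)]
        simp only [integral_const_mul, heq]
    _ ≤ 1 / ((n : ℝ) + 1) * (((n : ℝ) + 1) * ∫ z, G z ∂P + β * Real.log c) := by gcongr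
    _ = _ := by field_simp

end MirrorAveraging

/-! ### The one-dimensional factor of the sparsity prior -/

section Kernel

/-- The unnormalized scaled Student density `(τ² + t²)⁻²`. -/
noncomputable def studentKernel (τ t : ℝ) : ℝ := ((τ ^ 2 + t ^ 2) ^ 2)⁻¹

variable {τ : ℝ}

theorem studentKernel_pos (hτ : 0 < τ) (t : ℝ) : 0 < studentKernel τ t := by
  unfold studentKernel; positivity

theorem measurable_studentKernel : Measurable (studentKernel τ) := by
  unfold studentKernel; fun_prop

theorem integrable_inv_sq_add_sq (hτ : 0 < τ) : Integrable fun t : ℝ => (τ ^ 2 + t ^ 2)⁻¹ := by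
  have h := ((integrable_inv_one_add_sq).comp_div hτ.ne').const_mul (τ ^ 2)⁻¹
  refine h.congr (Filter.Eventually.of_forall fun t => ?_)
  have : 0 < τ ^ 2 + t ^ 2 := by positivity
  simp only
  field_simp

theorem integrable_sq_mul_studentKernel (hτ : 0 < τ) :
    Integrable fun t => t ^ 2 * studentKernel τ t := by
  refine (integrable_inv_sq_add_sq hτ).mono'
    ((measurable_id.pow_const 2).mul measurable_studentKernel).aestronglyMeasurable
    (Filter.Eventually.of_forall fun t => ?_)
  have h := studentKernel_pos hτ t
  rw [Real.norm_eq_abs, abs_of_nonneg (by positivity)]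
  have : 0 < τ ^ 2 + t ^ 2 := by positivity
  unfold studentKernel
  rw [← div_eq_mul_inv, inv_eq_one_div, div_le_div_iff₀ (by positivity) this]
  nlinarith [sq_nonneg τ]

theorem integrable_studentKernel (hτ : 0 < τ) : Integrable (studentKernel τ) := by
  refine ((integrable_inv_sq_add_sq hτ).const_mul (τ ^ 2)⁻¹).mono'
    measurable_studentKernel.aestronglyMeasurable (Filter.Eventually.of_forall fun t => ?_)
  rw [Real.norm_eq_abs, abs_of_pos (studentKernel_pos hτ t)]
  have : 0 < τ ^ 2 + t ^ 2 := by positivity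
  unfold studentKernel
  rw [← mul_inv]
  gcongr
  nlinarith [sq_nonneg t]

theorem integral_studentKernel_pos (hτ : 0 < τ) : 0 < ∫ t, studentKernel τ t := by
  rw [integral_pos_iff_support_of_nonneg (fun t => (studentKernel_pos hτ t).le)
    (integrable_studentKernel hτ)]
  have : Function.support (studentKernel τ) = Set.univ :=
    Set.eq_univ_of_forall fun t => (studentKernel_pos hτ t).ne'
  simp [this]

/-- The second moment of the Student kernel is `τ²` times its mass. -/
theorem integral_sq_mul_studentKernel (hτ : 0 < τ) :
    ∫ t, t ^ 2 * studentKernel τ t = τ ^ 2 * ∫ t, studentKernel τ t := by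
  have hi := (integrable_studentKernel hτ).const_mul (τ ^ 2)
  -- The function `t / (τ² + t²)` is a primitive of `(τ² - t²) / (τ² + t²)²` and vanishes at both
  -- infinities.
  have hd : ∀ t : ℝ, HasDerivAt (fun t => t / (τ ^ 2 + t ^ 2))
      (τ ^ 2 * studentKernel τ t - t ^ 2 * studentKernel τ t) t := fun t => by
    have h0 : τ ^ 2 + t ^ 2 ≠ 0 := by positivity
    have h := (hasDerivAt_id t).div ((hasDerivAt_pow 2 t).const_add (τ ^ 2)) h0
    refine HasDerivAt.congr_deriv (f := fun t => t / (τ ^ 2 + t ^ 2)) h ?_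
    simp only [studentKernel, id, Nat.cast_ofNat]
    field_simp
    ring
  have hlim : Filter.Tendsto (fun t : ℝ => t / (τ ^ 2 + t ^ 2)) (Filter.cocompact ℝ)
      (nhds 0) := by
    refine squeeze_zero_norm' (a := fun t : ℝ => ‖t‖⁻¹) ?_
      (tendsto_inv_atTop_zero.comp tendsto_norm_cocompact_atTop)
    have hne : ∀ᶠ t : ℝ in Filter.cocompact ℝ, t ≠ 0 := by
      simpa using (isCompact_singleton (x := (0 : ℝ))).compl_mem_cocompact
    filter_upwards [hne] with t ht
    have ht' : 0 < |t| := abs_pos.2 ht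
    rw [norm_div, Real.norm_eq_abs, Real.norm_eq_abs,
      abs_of_pos (by positivity : 0 < τ ^ 2 + t ^ 2), ← one_div,
      div_le_div_iff₀ (by positivity) ht']
    nlinarith [sq_abs t, sq_nonneg τ]
  have h := integral_of_hasDerivAt_of_tendsto hd (hi.sub (integrable_sq_mul_studentKernel hτ))
    (hlim.mono_left (by rw [cocompact_eq_atBot_atTop]; exact le_sup_left))
    (hlim.mono_left (by rw [cocompact_eq_atBot_atTop]; exact le_sup_right))
  rw [integral_sub hi (integrable_sq_mul_studentKernel hτ), integral_const_mul] at h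
  linarith

/-- The inequality `2τ|t| ≤ τ² + t²`. Since the second moment is `τ²` times the mass, each term on
the right integrates to `τ/2` times the mass. -/
theorem abs_mul_studentKernel_le (hτ : 0 < τ) (t : ℝ) :
    |t| * studentKernel τ t
      ≤ τ / 2 * studentKernel τ t + 1 / (2 * τ) * (t ^ 2 * studentKernel τ t) := by
  have h : |t| ≤ τ / 2 + 1 / (2 * τ) * t ^ 2 := by
    have : τ / 2 + 1 / (2 * τ) * t ^ 2 - |t| = 1 / (2 * τ) * (|t| - τ) ^ 2 := by
      rw [sub_sq, sq_abs]
      field_simp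
      ring
    nlinarith [show 0 ≤ 1 / (2 * τ) * (|t| - τ) ^ 2 by positivity]
  nlinarith [mul_le_mul_of_nonneg_right h (studentKernel_pos hτ t).le]

theorem integrable_abs_mul_studentKernel (hτ : 0 < τ) :
    Integrable fun t => |t| * studentKernel τ t := by
  refine (((integrable_studentKernel hτ).const_mul (τ / 2)).add
    ((integrable_sq_mul_studentKernel hτ).const_mul (1 / (2 * τ)))).mono'
    (measurable_norm.mul measurable_studentKernel).aestronglyMeasurable
    (Filter.Eventually.of_forall fun t => ?_)
  have h := studentKernel_pos hτ t
  rw [Real.norm_eq_abs, abs_of_nonneg (by positivity)]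
  exact abs_mul_studentKernel_le hτ t

theorem integral_abs_mul_studentKernel_le (hτ : 0 < τ) :
    ∫ t, |t| * studentKernel τ t ≤ τ * ∫ t, studentKernel τ t := by
  have h1 := (integrable_studentKernel hτ).const_mul (τ / 2)
  have h2 := (integrable_sq_mul_studentKernel hτ).const_mul (1 / (2 * τ))
  refine (integral_mono (integrable_abs_mul_studentKernel hτ) (h1.add h2)
    (abs_mul_studentKernel_le hτ)).trans_eq ?_
  simp only [Pi.add_apply]
  rw [integral_add h1 h2, integral_const_mul, integral_const_mul,
    integral_sq_mul_studentKernel hτ]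
  field_simp
  ring

/-- The kernel at a translated point is controlled by the kernel at the original point. -/
theorem studentKernel_le_of_add (hτ : 0 < τ) (a b : ℝ) :
    studentKernel τ a ≤ (1 + τ⁻¹ * |b|) ^ 4 * studentKernel τ (b + a) := by
  have hc : 0 ≤ τ⁻¹ * |b| := by positivity
  have hb : |b| = τ * (τ⁻¹ * |b|) := by field_simp
  set c := τ⁻¹ * |b| with hcdef
  have hba : b * a ≤ τ * c * |a| := by
    rw [← hb, ← abs_mul]; exact le_abs_self _
  have hb2 : b ^ 2 = τ ^ 2 * c ^ 2 := by rw [← sq_abs, hb]; ring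
  -- The cross term satisfies `2ba ≤ 2τc|a| ≤ c(τ² + a²)`, and `b² = τ²c²`.
  have key : τ ^ 2 + (b + a) ^ 2 ≤ (1 + c) ^ 2 * (τ ^ 2 + a ^ 2) := by
    nlinarith [mul_nonneg hc (sq_nonneg (τ - |a|)), sq_abs a,
      mul_nonneg (sq_nonneg c) (sq_nonneg a)]
  unfold studentKernel
  have h1 : 0 < τ ^ 2 + (b + a) ^ 2 := by positivity
  have h2 : 0 < τ ^ 2 + a ^ 2 := by positivity
  rw [← div_eq_mul_inv, inv_eq_one_div, div_le_div_iff₀ (by positivity) (by positivity), one_mul]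
  calc (τ ^ 2 + (b + a) ^ 2) ^ 2 ≤ ((1 + c) ^ 2 * (τ ^ 2 + a ^ 2)) ^ 2 := by gcongr
    _ = _ := by ring

end Kernel

/-! ### The sparsity prior -/

section Prior

variable {M : ℕ} {τ R : ℝ}

theorem isCompact_l1Ball (M : ℕ) (r : ℝ) : IsCompact (l1Ball M r) := by
  refine Metric.isCompact_of_isClosed_isBounded ?_ ?_
  · exact isClosed_le (by fun_prop) continuous_const
  · refine (Metric.isBounded_closedBall (x := (0 : Fin M → ℝ)) (r := |r|)).subset fun l hl => ?_
    rw [mem_closedBall_zero_iff, pi_norm_le_iff_of_nonneg (abs_nonneg _)]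
    intro j
    exact ((Finset.single_le_sum (f := fun j => |l j|) (fun _ _ => abs_nonneg _)
      (Finset.mem_univ j)).trans hl).trans (le_abs_self r)

theorem measurableSet_l1Ball (M : ℕ) (r : ℝ) : MeasurableSet (l1Ball M r) :=
  (isCompact_l1Ball M r).measurableSet

/-- The unrestricted product density. -/
noncomputable def studentProd (M : ℕ) (τ : ℝ) (l : Fin M → ℝ) : ℝ := ∏ j, studentKernel τ (l j)

theorem sparsityWeight_eq (M : ℕ) (τ R : ℝ) :
    sparsityWeight M τ R = (l1Ball M R).indicator (studentProd M τ) := rfl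

theorem studentProd_pos (hτ : 0 < τ) (l : Fin M → ℝ) : 0 < studentProd M τ l :=
  Finset.prod_pos fun _ _ => studentKernel_pos hτ _

theorem measurable_studentProd : Measurable (studentProd M τ) :=
  Finset.measurable_prod _ fun j _ => measurable_studentKernel.comp (measurable_pi_apply j)

theorem measurable_sparsityWeight : Measurable (sparsityWeight M τ R) :=
  measurable_studentProd.indicator (measurableSet_l1Ball M R)

/-! ### Mass of the product density and of its restriction to the ball. -/

theorem integrable_studentProd (hτ : 0 < τ) : Integrable (studentProd M τ) :=
  Integrable.fintype_prod fun _ => integrable_studentKernel hτ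

theorem integral_studentProd : ∫ l, studentProd M τ l = (∫ t, studentKernel τ t) ^ M := by
  simp only [studentProd]
  rw [integral_fintype_prod_volume_eq_prod (fun (_ : Fin M) t => studentKernel τ t)]
  simp

theorem integrable_sparsityWeight (hτ : 0 < τ) : Integrable (sparsityWeight M τ R) :=
  (integrable_studentProd hτ).indicator (measurableSet_l1Ball M R)

theorem sparsityWeight_nonneg (hτ : 0 < τ) (l : Fin M → ℝ) : 0 ≤ sparsityWeight M τ R l :=
  Set.indicator_nonneg (fun l _ => (studentProd_pos hτ l).le) l

theorem sparsityWeight_le (hτ : 0 < τ) (l : Fin M → ℝ) :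
    sparsityWeight M τ R l ≤ studentProd M τ l :=
  Set.indicator_le_self' (fun l _ => (studentProd_pos hτ l).le) l

/-- Absorbing `g` into factor `j` keeps the integrand a product, so integrals factor into
one-dimensional ones. -/
theorem comp_mul_studentProd (g : ℝ → ℝ) (j : Fin M) (l : Fin M → ℝ) :
    g (l j) * studentProd M τ l
      = ∏ i, (if i = j then fun t => g t * studentKernel τ t else studentKernel τ) (l i) := by
  rw [← Finset.mul_prod_erase _ _ (Finset.mem_univ j), studentProd,
    ← Finset.mul_prod_erase _ _ (Finset.mem_univ j), if_pos rfl, mul_assoc]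
  congr 2
  refine Finset.prod_congr rfl fun i hi => ?_
  rw [if_neg (Finset.ne_of_mem_erase hi)]

theorem integrable_comp_mul_studentProd (hτ : 0 < τ) {g : ℝ → ℝ}
    (hg : Integrable fun t => g t * studentKernel τ t) (j : Fin M) :
    Integrable fun l : Fin M → ℝ => g (l j) * studentProd M τ l := by
  simp only [comp_mul_studentProd]
  refine Integrable.fintype_prod fun i => ?_
  split_ifs
  · exact hg
  · exact integrable_studentKernel hτ

theorem integral_comp_mul_studentProd_le (hτ : 0 < τ) {g : ℝ → ℝ} {a : ℝ}
    (hg : ∫ t, g t * studentKernel τ t ≤ a * ∫ t, studentKernel τ t) (j : Fin M) :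
    ∫ l : Fin M → ℝ, g (l j) * studentProd M τ l ≤ a * ∫ l, studentProd M τ l := by
  simp only [comp_mul_studentProd]
  rw [integral_fintype_prod_volume_eq_prod (fun i =>
    if i = j then fun t => g t * studentKernel τ t else studentKernel τ), integral_studentProd,
    ← Finset.mul_prod_erase _ _ (Finset.mem_univ j), if_pos rfl]
  have h : ∏ i ∈ Finset.univ.erase j, ∫ t, (if i = j then fun t => g t * studentKernel τ t
      else studentKernel τ) t = (∫ t, studentKernel τ t) ^ (M - 1) := by
    rw [Finset.prod_congr rfl (g := fun _ => ∫ t, studentKernel τ t)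
      fun i hi => by rw [if_neg (Finset.ne_of_mem_erase hi)]]
    simp [Finset.card_erase_of_mem]
  have hM : M = M - 1 + 1 := by have := j.pos; omega
  have hI := integral_studentKernel_pos hτ
  rw [h]
  conv_rhs => rw [hM, pow_succ, mul_comm (_ ^ _), ← mul_assoc]
  exact mul_le_mul_of_nonneg_right hg (by positivity)

/-- At least half of the mass of the product density lies in the `ℓ¹`-ball of radius `2 M τ`. -/
theorem integral_studentProd_le_two_mul (hM : 0 < M) (hτ : 0 < τ) (hR : 2 * (M : ℝ) * τ ≤ R) :
    ∫ l, studentProd M τ l ≤ 2 * ∫ l, sparsityWeight M τ R l := by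
  have hM' : (0 : ℝ) < M := by exact_mod_cast hM
  have hi : ∀ j : Fin M, Integrable fun l : Fin M → ℝ => |l j| * studentProd M τ l := fun j =>
    integrable_comp_mul_studentProd hτ (g := fun t => |t|) (integrable_abs_mul_studentKernel hτ) j
  have hi' := (integrable_finsetSum Finset.univ fun j _ => hi j).const_mul (1 / (2 * M * τ))
  -- Markov's inequality in pointwise form: outside the ball `‖l‖₁ / (2Mτ)` is at least one. The `M`
  -- first absolute moments, each at most `τ` times the mass, then account for at most half of it.
  have hpt : ∀ l : Fin M → ℝ, studentProd M τ l
      ≤ sparsityWeight M τ R l + 1 / (2 * M * τ) * ∑ j, |l j| * studentProd M τ l := fun l => by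
    have hp := studentProd_pos hτ l
    by_cases hl : l ∈ l1Ball M R
    · rw [sparsityWeight_eq, Set.indicator_of_mem hl, ← Finset.sum_mul]
      have : 0 ≤ ∑ j, |l j| := Finset.sum_nonneg fun _ _ => abs_nonneg _
      have : 0 ≤ 1 / (2 * M * τ) * ((∑ j, |l j|) * studentProd M τ l) := by positivity
      linarith
    · rw [sparsityWeight_eq, Set.indicator_of_notMem hl, ← Finset.sum_mul, zero_add, ← mul_assoc]
      have h1 : R < ∑ j, |l j| := not_le.1 hl
      refine le_mul_of_one_le_left hp.le ?_
      rw [one_div, inv_mul_eq_div, one_le_div (by positivity)]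
      linarith
  have h := integral_mono (integrable_studentProd hτ)
    ((integrable_sparsityWeight hτ).add hi') hpt
  simp only [Pi.add_apply] at h
  rw [integral_add (integrable_sparsityWeight hτ) hi', integral_const_mul,
    integral_finsetSum _ fun j _ => hi j] at h
  have hs : ∑ j : Fin M, ∫ l : Fin M → ℝ, |l j| * studentProd M τ l
      ≤ ∑ _j : Fin M, τ * ∫ l, studentProd M τ l := Finset.sum_le_sum fun j _ =>
    integral_comp_mul_studentProd_le hτ (g := fun t => |t|)
      (integral_abs_mul_studentKernel_le hτ) j
  rw [Finset.sum_const, Finset.card_univ, Fintype.card_fin, nsmul_eq_mul] at hs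
  have h2 := mul_le_mul_of_nonneg_left hs (by positivity : 0 ≤ 1 / (2 * (M : ℝ) * τ))
  have h3 : 1 / (2 * (M : ℝ) * τ) * (M * (τ * ∫ l, studentProd M τ l))
      = (∫ l, studentProd M τ l) / 2 := by field_simp
  linarith

theorem integral_sparsityWeight_pos (hM : 0 < M) (hτ : 0 < τ) (hR : 2 * (M : ℝ) * τ ≤ R) :
    0 < ∫ l, sparsityWeight M τ R l := by
  have h := integral_studentProd_le_two_mul hM hτ hR
  have h2 : 0 < ∫ l, studentProd M τ l := by
    rw [integral_studentProd]; exact pow_pos (integral_studentKernel_pos hτ) _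
  linarith

theorem integral_sparsityWeight_le (hτ : 0 < τ) :
    ∫ l, sparsityWeight M τ R l ≤ ∫ l, studentProd M τ l :=
  integral_mono (integrable_sparsityWeight hτ) (integrable_studentProd hτ) (sparsityWeight_le hτ)

theorem isProbabilityMeasure_sparsityPrior (hM : 0 < M) (hτ : 0 < τ)
    (hR : 2 * (M : ℝ) * τ ≤ R) : IsProbabilityMeasure (sparsityPrior M τ R) := by
  have hC := integral_sparsityWeight_pos hM hτ hR
  refine ⟨?_⟩
  rw [sparsityPrior, withDensity_apply _ MeasurableSet.univ, Measure.restrict_univ,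
    ← ofReal_integral_eq_lintegral_ofReal ((integrable_sparsityWeight hτ).div_const _)
      (Filter.Eventually.of_forall fun l => div_nonneg (sparsityWeight_nonneg hτ l) hC.le),
    integral_div, div_self hC.ne', ENNReal.ofReal_one]

theorem ae_mem_l1Ball : ∀ᵐ l ∂(sparsityPrior M τ R), l ∈ l1Ball M R := by
  rw [sparsityPrior, ae_withDensity_iff
    (measurable_sparsityWeight.div_const _).ennreal_ofReal]
  refine Filter.Eventually.of_forall fun l hl => ?_
  by_contra h
  simp [sparsityWeight_eq, Set.indicator_of_notMem h] at hl

/-! ### Moments of the sparsity prior. -/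

theorem integral_sparsityPrior (hτ : 0 < τ) (g : (Fin M → ℝ) → ℝ) :
    ∫ l, g l ∂(sparsityPrior M τ R)
      = ∫ l, sparsityWeight M τ R l / (∫ w, sparsityWeight M τ R w) * g l := by
  rw [sparsityPrior, integral_withDensity_eq_integral_toReal_smul
    (measurable_sparsityWeight.div_const _).ennreal_ofReal (by simp)]
  refine integral_congr_ae (Filter.Eventually.of_forall fun l => ?_)
  simp only [smul_eq_mul]
  rw [ENNReal.toReal_ofReal (div_nonneg (sparsityWeight_nonneg hτ l)
    (integral_nonneg (sparsityWeight_nonneg hτ)))]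

/-- The product density gives `τ²`; renormalizing after restriction to the ball costs at most the
factor 2. -/
theorem integral_sq_sparsityPrior_le (hM : 0 < M) (hτ : 0 < τ) (hR : 2 * (M : ℝ) * τ ≤ R)
    (j : Fin M) : ∫ l, l j ^ 2 ∂(sparsityPrior M τ R) ≤ 2 * τ ^ 2 := by
  have hC := integral_sparsityWeight_pos hM hτ hR
  have hi : Integrable fun l : Fin M → ℝ => l j ^ 2 * studentProd M τ l :=
    integrable_comp_mul_studentProd hτ (g := fun t => t ^ 2)
      (integrable_sq_mul_studentKernel hτ) j
  have hm := integral_comp_mul_studentProd_le hτ (g := fun t => t ^ 2)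
      (integral_sq_mul_studentKernel hτ).le j
  rw [integral_sparsityPrior hτ]
  set C := ∫ w, sparsityWeight M τ R w
  calc ∫ l, sparsityWeight M τ R l / C * l j ^ 2
      ≤ ∫ l : Fin M → ℝ, C⁻¹ * (l j ^ 2 * studentProd M τ l) := by
        refine integral_mono_of_nonneg (Filter.Eventually.of_forall fun l => ?_)
          (hi.const_mul _) (Filter.Eventually.of_forall fun l => ?_)
        · have := sparsityWeight_nonneg (R := R) hτ l
          simp only [Pi.zero_apply]
          positivity
        · simp only
          rw [div_eq_inv_mul, mul_assoc, mul_comm (l j ^ 2)]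
          have := sparsityWeight_le (R := R) hτ l
          gcongr
    _ ≤ C⁻¹ * (τ ^ 2 * (2 * C)) := by
        rw [integral_const_mul]
        have := integral_studentProd_le_two_mul hM hτ hR
        gcongr
        exact hm.trans (by gcongr)
    _ = 2 * τ ^ 2 := by field_simp

/-- Changing the sign of the coordinate `j`. -/
def flipSign (j : Fin M) (l : Fin M → ℝ) : Fin M → ℝ := fun i => if i = j then -l i else l i

theorem measurePreserving_flipSign (j : Fin M) :
    MeasurePreserving (flipSign j) (volume : Measure (Fin M → ℝ)) volume := by
  refine measurePreserving_pi (fun _ => volume) (fun _ => volume)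
    (f := fun i t => if i = j then -t else t) fun i => ?_
  by_cases h : i = j
  · simp only [h, if_true]; exact Measure.measurePreserving_neg volume
  · simp only [h, if_false]; exact MeasurePreserving.id _

theorem sparsityWeight_flipSign (j : Fin M) (l : Fin M → ℝ) :
    sparsityWeight M τ R (flipSign j l) = sparsityWeight M τ R l := by
  have h1 : ∀ i, |flipSign j l i| = |l i| := fun i => by
    unfold flipSign; split_ifs <;> simp
  have h2 : studentProd M τ (flipSign j l) = studentProd M τ l :=
    Finset.prod_congr rfl fun i _ => by
      unfold studentKernel; rw [← sq_abs (flipSign j l i), h1, sq_abs]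
  have h3 : flipSign j l ∈ l1Ball M R ↔ l ∈ l1Ball M R := by
    simp [l1Ball, h1]
  by_cases h : l ∈ l1Ball M R
  · rw [sparsityWeight_eq, Set.indicator_of_mem h, Set.indicator_of_mem (h3.2 h), h2]
  · rw [sparsityWeight_eq, Set.indicator_of_notMem h, Set.indicator_of_notMem (mt h3.1 h)]

/-- Both the weight and Lebesgue measure are invariant under the sign flip, so the integral equals
its own negative. -/
theorem integral_sparsityPrior_eq_zero_of_odd (hτ : 0 < τ) {g : (Fin M → ℝ) → ℝ}
    (hg : Measurable g) (j : Fin M) (hodd : ∀ l, g (flipSign j l) = -g l) :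
    ∫ l, g l ∂(sparsityPrior M τ R) = 0 := by
  rw [integral_sparsityPrior hτ]
  set C := ∫ w, sparsityWeight M τ R w
  have h : ∫ l, sparsityWeight M τ R l / C * g l = -∫ l, sparsityWeight M τ R l / C * g l := by
    have hmap := integral_map (measurePreserving_flipSign j).measurable.aemeasurable
      (f := fun l => sparsityWeight M τ R l / C * g l) (μ := volume)
      ((measurable_sparsityWeight.div_const C).mul hg).aestronglyMeasurable
    rw [(measurePreserving_flipSign j).map_eq] at hmap
    simp only [sparsityWeight_flipSign, hodd, mul_neg, integral_neg] at hmap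
    exact hmap
  linarith

theorem integral_apply_sparsityPrior (hτ : 0 < τ) (j : Fin M) :
    ∫ l, l j ∂(sparsityPrior M τ R) = 0 :=
  integral_sparsityPrior_eq_zero_of_odd hτ (measurable_pi_apply j) j fun l => by simp [flipSign]

theorem integral_mul_sparsityPrior (hτ : 0 < τ) {i j : Fin M} (hij : i ≠ j) :
    ∫ l, l i * l j ∂(sparsityPrior M τ R) = 0 :=
  integral_sparsityPrior_eq_zero_of_odd hτ
    ((measurable_pi_apply i).mul (measurable_pi_apply j)) j fun l => by simp [flipSign, hij]

theorem integrable_sparsityPrior_of_continuous (hM : 0 < M) (hτ : 0 < τ)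
    (hR : 2 * (M : ℝ) * τ ≤ R) {g : (Fin M → ℝ) → ℝ} (hg : Continuous g) :
    Integrable g (sparsityPrior M τ R) := by
  have := isProbabilityMeasure_sparsityPrior hM hτ hR
  obtain ⟨D, hD⟩ := (isCompact_l1Ball M R).exists_bound_of_continuousOn hg.continuousOn
  exact Integrable.of_bound (C := D) hg.aestronglyMeasurable (ae_mem_l1Ball.mono hD)

theorem integral_linear_sparsityPrior (hM : 0 < M) (hτ : 0 < τ) (hR : 2 * (M : ℝ) * τ ≤ R)
    (v : Fin M → ℝ) : ∫ l, ∑ j, l j * v j ∂(sparsityPrior M τ R) = 0 := by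
  rw [integral_finsetSum _ fun j _ =>
    integrable_sparsityPrior_of_continuous hM hτ hR (by fun_prop)]
  simp [integral_mul_const, integral_apply_sparsityPrior hτ]

/-- Distinct coordinates are uncorrelated by sign symmetry, although restriction to the ball
destroys the product structure; only the diagonal terms survive. -/
theorem integral_linear_sq_sparsityPrior_le (hM : 0 < M) (hτ : 0 < τ)
    (hR : 2 * (M : ℝ) * τ ≤ R) (v : Fin M → ℝ) :
    ∫ l, (∑ j, l j * v j) ^ 2 ∂(sparsityPrior M τ R) ≤ 2 * τ ^ 2 * ∑ j, v j ^ 2 := by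
  have hexp : ∀ l : Fin M → ℝ, (∑ j, l j * v j) ^ 2 = ∑ i, ∑ j, l i * l j * (v i * v j) :=
    fun l => by
      rw [sq, Finset.sum_mul_sum]
      exact Finset.sum_congr rfl fun i _ => Finset.sum_congr rfl fun j _ => by ring
  have hint : ∀ i j : Fin M, Integrable (fun l => l i * l j * (v i * v j))
      (sparsityPrior M τ R) := fun i j =>
    integrable_sparsityPrior_of_continuous hM hτ hR (by fun_prop)
  simp only [hexp]
  rw [integral_finsetSum _ fun i _ => integrable_finsetSum _ fun j _ => hint i j, Finset.mul_sum]
  refine Finset.sum_le_sum fun i _ => ?_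
  rw [integral_finsetSum _ fun j _ => hint i j, Finset.sum_eq_single i]
  · rw [integral_mul_const]
    have := integral_sq_sparsityPrior_le hM hτ hR i
    simp only [sq (_ : ℝ)] at this ⊢
    gcongr
    exact mul_self_nonneg _
  · intro j _ hj
    rw [integral_mul_const, integral_mul_sparsityPrior hτ hj.symm, zero_mul]
  · simp

/-- The prior concentrated on the small ball and translated to `l₀` has a density with respect to
the full prior which is logarithmic in the coefficients of `l₀`. -/
theorem map_sparsityPrior_le (hM : 0 < M) (hτ : 0 < τ) {l₀ : Fin M → ℝ}
    (hl₀ : l₀ ∈ l1Ball M (R - 2 * (M : ℝ) * τ)) :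
    (sparsityPrior M τ (2 * (M : ℝ) * τ)).map (fun l => l₀ + l) ≤
      ENNReal.ofReal (2 * ∏ j, (1 + τ⁻¹ * |l₀ j|) ^ 4) • sparsityPrior M τ R := by
  have hR : 2 * (M : ℝ) * τ ≤ R := by
    have h : ∑ j, |l₀ j| ≤ R - 2 * (M : ℝ) * τ := hl₀
    have : 0 ≤ ∑ j, |l₀ j| := Finset.sum_nonneg fun _ _ => abs_nonneg _
    linarith
  have hC₀ := integral_sparsityWeight_pos hM hτ le_rfl
  have hC := integral_sparsityWeight_pos hM hτ hR
  -- `C ≤ 2 C₀`, through the mass of the unrestricted product: the origin of the factor 2 in the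
  -- density bound.
  have hCC := (integral_sparsityWeight_le (M := M) (R := R) hτ).trans
    (integral_studentProd_le_two_mul hM hτ le_rfl)
  set C₀ := ∫ l, sparsityWeight M τ (2 * (M : ℝ) * τ) l
  set C := ∫ l, sparsityWeight M τ R l
  set K := ∏ j, (1 + τ⁻¹ * |l₀ j|) ^ 4 with hK
  have hK0 : 0 < K := Finset.prod_pos fun j _ => by positivity
  have hpt : ∀ l, sparsityWeight M τ (2 * (M : ℝ) * τ) l / C₀
      ≤ 2 * K * (sparsityWeight M τ R (l₀ + l) / C) := fun l => by
    by_cases hl : l ∈ l1Ball M (2 * (M : ℝ) * τ)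
    · have hl' : l₀ + l ∈ l1Ball M R := by
        have h1 : ∑ j, |l₀ j| ≤ R - 2 * (M : ℝ) * τ := hl₀
        have h2 : ∑ j, |l j| ≤ 2 * (M : ℝ) * τ := hl
        have h3 : ∑ j, |(l₀ + l) j| ≤ ∑ j, (|l₀ j| + |l j|) :=
          Finset.sum_le_sum fun j _ => abs_add_le _ _
        rw [Finset.sum_add_distrib] at h3
        exact h3.trans (by linarith)
      rw [sparsityWeight_eq, sparsityWeight_eq, Set.indicator_of_mem hl,
        Set.indicator_of_mem hl']
      have hp : studentProd M τ l ≤ K * studentProd M τ (l₀ + l) := by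
        rw [hK, studentProd, studentProd, ← Finset.prod_mul_distrib]
        exact Finset.prod_le_prod (fun j _ => (studentKernel_pos hτ _).le)
          fun j _ => studentKernel_le_of_add hτ _ _
      have hpos := studentProd_pos hτ (l₀ + l)
      rw [← mul_div_assoc, div_le_div_iff₀ hC₀ hC]
      calc studentProd M τ l * C ≤ (K * studentProd M τ (l₀ + l)) * (2 * C₀) := by gcongr
        _ = _ := by ring
    · rw [sparsityWeight_eq, Set.indicator_of_notMem hl, zero_div]
      have := sparsityWeight_nonneg (R := R) hτ (l₀ + l)
      positivity
  -- Translation invariance of Lebesgue measure moves the right-hand integral to the variable `l₀ +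
  -- l`, where `hpt` compares the densities.
  refine Measure.le_iff.2 fun s hs => ?_
  have hm : Measurable fun l : Fin M → ℝ => l₀ + l := measurable_const_add l₀
  rw [Measure.map_apply hm hs, Measure.smul_apply, sparsityPrior, sparsityPrior,
    withDensity_apply _ (hm hs), withDensity_apply _ hs, smul_eq_mul,
    ← lintegral_const_mul _ (measurable_sparsityWeight.div_const _).ennreal_ofReal,
    ← lintegral_indicator hs, ← lintegral_indicator (hm hs),
    ← lintegral_add_left_eq_self (s.indicator _) l₀]
  refine lintegral_mono fun l => ?_
  by_cases hl : l₀ + l ∈ s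
  · rw [Set.indicator_of_mem (show l ∈ (fun l => l₀ + l) ⁻¹' s from hl),
      Set.indicator_of_mem hl, ← ENNReal.ofReal_mul (by positivity)]
    exact ENNReal.ofReal_le_ofReal (hpt l)
  · rw [Set.indicator_of_notMem (show l ∉ (fun l => l₀ + l) ⁻¹' s from hl)]
    exact zero_le

end Prior

/-! ### Convexity properties of the loss -/

section Loss

variable {Φ : ℝ → ℝ}

theorem hasDerivAt_deriv_of_contDiff_two (hΦ : ContDiff ℝ 2 Φ) (u : ℝ) :
    HasDerivAt (deriv Φ) (iteratedDeriv 2 Φ u) u := by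
  have h := (hΦ.differentiable_iteratedDeriv 1 (by norm_num) u).hasDerivAt
  rw [← iteratedDeriv_succ, iteratedDeriv_one] at h
  exact h

theorem hasDerivAt_of_contDiff_two (hΦ : ContDiff ℝ 2 Φ) (u : ℝ) :
    HasDerivAt Φ (deriv Φ u) u :=
  (hΦ.differentiable (by norm_num) u).hasDerivAt

theorem iteratedDeriv_two_nonneg (hΦ : ContDiff ℝ 2 Φ) (hconv : ConvexOn ℝ Set.univ Φ) (u : ℝ) :
    0 ≤ iteratedDeriv 2 Φ u := by
  have hmono : Monotone (deriv Φ) := monotoneOn_univ.1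
    (hconv.monotoneOn_deriv fun x _ => (hasDerivAt_of_contDiff_two hΦ x).differentiableAt)
  rw [← (hasDerivAt_deriv_of_contDiff_two hΦ u).deriv]
  exact hmono.deriv_nonneg

/-- Clearing the denominator remains valid where the second derivative vanishes: a finite ratio in
`ℝ≥0∞` then forces the first derivative to vanish too. -/
theorem sq_deriv_le_of_betaPhi_le (hΦ : ContDiff ℝ 2 Φ) (hconv : ConvexOn ℝ Set.univ Φ)
    {β B : ℝ} (hβ : 0 < β) (h : betaPhi Φ B ≤ ENNReal.ofReal β) {u : ℝ}
    (hu : u ∈ Set.Icc (-B) B) : deriv Φ u ^ 2 ≤ β * iteratedDeriv 2 Φ u := by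
  have h1 : ENNReal.ofReal (deriv Φ u ^ 2) / ENNReal.ofReal (iteratedDeriv 2 Φ u)
      ≤ ENNReal.ofReal β := (le_iSup₂_of_le u hu le_rfl).trans h
  rw [ENNReal.div_le_iff_le_mul (Or.inr ENNReal.ofReal_ne_top) (Or.inl ENNReal.ofReal_ne_top),
    ← ENNReal.ofReal_mul hβ.le] at h1
  exact (ENNReal.ofReal_le_ofReal_iff
    (mul_nonneg hβ.le (iteratedDeriv_two_nonneg hΦ hconv u))).1 h1

/-- The second derivative is `exp(-Φ/β) (Φ'²/β² - Φ''/β)`, which is nonpositive exactly when `Φ'² ≤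
β Φ''`. -/
theorem concaveOn_exp_neg_of_betaPhi_le (hΦ : ContDiff ℝ 2 Φ) (hconv : ConvexOn ℝ Set.univ Φ)
    {β B : ℝ} (hβ : 0 < β) (h : betaPhi Φ B ≤ ENNReal.ofReal β) :
    ConcaveOn ℝ (Set.Icc (-B) B) fun u => Real.exp (-(1 / β) * Φ u) := by
  have hd1 : ∀ u, HasDerivAt (fun u => Real.exp (-(1 / β) * Φ u))
      (Real.exp (-(1 / β) * Φ u) * (-(1 / β) * deriv Φ u)) u := fun u =>
    ((hasDerivAt_of_contDiff_two hΦ u).const_mul (-(1 / β))).exp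
  refine concaveOn_of_hasDerivWithinAt2_nonpos (convex_Icc _ _)
    (fun u _ => (hd1 u).continuousAt.continuousWithinAt)
    (fun u _ => (hd1 u).hasDerivWithinAt)
    (fun u _ => ((hd1 u).mul
      ((hasDerivAt_deriv_of_contDiff_two hΦ u).const_mul (-(1 / β)))).hasDerivWithinAt)
    fun u hu => ?_
  have hsq := sq_deriv_le_of_betaPhi_le hΦ hconv hβ h (interior_subset hu)
  have h2 : (1 / β) ^ 2 * deriv Φ u ^ 2 ≤ 1 / β * iteratedDeriv 2 Φ u := by
    calc (1 / β) ^ 2 * deriv Φ u ^ 2 ≤ (1 / β) ^ 2 * (β * iteratedDeriv 2 Φ u) := by gcongr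
      _ = _ := by field_simp
  nlinarith [mul_le_mul_of_nonneg_left h2 (Real.exp_pos (-(1 / β) * Φ u)).le]

/-- The upper bound on curvature stated as convexity, so that Jensen can replace a Taylor expansion.
-/
theorem convexOn_sq_sub {B s : ℝ} (hΦ : ContDiff ℝ 2 Φ)
    (hs : ∀ u ∈ Set.Icc (-B) B, iteratedDeriv 2 Φ u ≤ s) :
    ConvexOn ℝ (Set.Icc (-B) B) fun u => s / 2 * u ^ 2 - Φ u := by
  have hd1 : ∀ u, HasDerivAt (fun u => s / 2 * u ^ 2 - Φ u) (s * u - deriv Φ u) u := fun u => by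
    refine (((hasDerivAt_pow 2 u).const_mul (s / 2)).sub
      (hasDerivAt_of_contDiff_two hΦ u)).congr_deriv ?_
    simp only [Nat.cast_ofNat]
    ring
  have hd2 : ∀ u, HasDerivAt (fun u => s * u - deriv Φ u) (s - iteratedDeriv 2 Φ u) u := fun u => by
    refine (((hasDerivAt_id u).const_mul s).sub
      (hasDerivAt_deriv_of_contDiff_two hΦ u)).congr_deriv ?_
    ring
  exact convexOn_of_hasDerivWithinAt2_nonneg (convex_Icc _ _)
    (fun u _ => (hd1 u).continuousAt.continuousWithinAt)
    (fun u _ => (hd1 u).hasDerivWithinAt) (fun u _ => (hd2 u).hasDerivWithinAt)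
    fun u hu => sub_nonneg.2 (hs u (interior_subset hu))

/-- Jensen for `s/2 * u² - Φ u` at the mean `h₀` gives `E Φ ≤ Φ h₀ + (s/2) Var`, and the variance is
at most `2 τ² ∑ v_j²`. -/
theorem integral_comp_linear_sparsityPrior_le {M : ℕ} {τ R B s : ℝ} (hM : 0 < M) (hτ : 0 < τ)
    (hR : 2 * (M : ℝ) * τ ≤ R) (hΦ : ContDiff ℝ 2 Φ) (hs0 : 0 ≤ s)
    (hs : ∀ u ∈ Set.Icc (-B) B, iteratedDeriv 2 Φ u ≤ s) (h₀ : ℝ) (v : Fin M → ℝ)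
    (hB : ∀ l ∈ l1Ball M R, |h₀ + ∑ j, l j * v j| ≤ B) :
    ∫ l, Φ (h₀ + ∑ j, l j * v j) ∂(sparsityPrior M τ R)
      ≤ Φ h₀ + s * τ ^ 2 * ∑ j, v j ^ 2 := by
  have := isProbabilityMeasure_sparsityPrior hM hτ hR
  set p := sparsityPrior M τ R
  have hc := hΦ.continuous
  have hi : ∀ {g : (Fin M → ℝ) → ℝ}, Continuous g → Integrable g p := fun hg =>
    integrable_sparsityPrior_of_continuous hM hτ hR hg
  have hmean : ∫ l, (h₀ + ∑ j, l j * v j) ∂p = h₀ := by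
    rw [integral_add (integrable_const _) (hi (by fun_prop)),
      integral_linear_sparsityPrior hM hτ hR]
    simp
  have hJ := (convexOn_sq_sub hΦ hs).map_integral_le (μ := p)
    (f := fun l => h₀ + ∑ j, l j * v j) (Continuous.continuousOn (by fun_prop)) isClosed_Icc
    (ae_mem_l1Ball.mono fun l hl => abs_le.1 (hB l hl)) (hi (by fun_prop))
    (hi (by fun_prop))
  simp only [hmean] at hJ
  have hexp : ∀ l : Fin M → ℝ, s / 2 * (h₀ + ∑ j, l j * v j) ^ 2 - Φ (h₀ + ∑ j, l j * v j)
      = s / 2 * h₀ ^ 2 + s * h₀ * (∑ j, l j * v j) + s / 2 * (∑ j, l j * v j) ^ 2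
        - Φ (h₀ + ∑ j, l j * v j) := fun l => by ring
  simp only [hexp] at hJ
  rw [integral_sub (hi (by fun_prop)) (hi (by fun_prop)),
    integral_add (hi (by fun_prop)) (hi (by fun_prop)),
    integral_add (hi (by fun_prop)) (hi (by fun_prop)), integral_const_mul, integral_const_mul,
    integral_const_mul, integral_linear_sparsityPrior hM hτ hR] at hJ
  have hq := mul_le_mul_of_nonneg_left (integral_linear_sq_sparsityPrior_le hM hτ hR v)
    (by positivity : 0 ≤ s / 2)
  simp only [integral_const, probReal_univ, smul_eq_mul, one_mul, mul_zero,
    add_zero] at hJ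
  nlinarith

end Loss

/-! ### Linear combinations of a bounded dictionary -/

section Dictionary

variable {X : Type*} {M n : ℕ}

theorem abs_label (y : Label) : |(y : ℝ)| = 1 := by
  rcases y.2 with h | h
  · rw [h]; norm_num
  · rw [Set.mem_singleton_iff.1 h]; norm_num

/-- The margin `-y f_λ(x)` of a linear combination of the dictionary. -/
def margin (φ : Fin M → X → ℝ) (p : X × Label) (l : Fin M → ℝ) : ℝ :=
  -(p.2 : ℝ) * linComb φ l p.1

theorem margin_add (φ : Fin M → X → ℝ) (p : X × Label) (l₀ l : Fin M → ℝ) :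
    margin φ p (l₀ + l) = margin φ p l₀ + ∑ j, l j * (-(p.2 : ℝ) * φ j p.1) := by
  simp only [margin, linComb, Pi.add_apply, add_mul, Finset.sum_add_distrib, mul_add,
    Finset.mul_sum]
  congr 1
  exact Finset.sum_congr rfl fun j _ => by ring

theorem abs_margin_le {φ : Fin M → X → ℝ} {p : X × Label} {L R : ℝ} (hL : 0 ≤ L)
    (hp : ∀ j, |φ j p.1| ≤ L) {l : Fin M → ℝ} (hl : l ∈ l1Ball M R) :
    |margin φ p l| ≤ R * L := by
  rw [margin, abs_mul, abs_neg, abs_label, one_mul, linComb]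
  calc |∑ j, l j * φ j p.1| ≤ ∑ j, |l j| * L :=
        (Finset.abs_sum_le_sum_abs _ _).trans (Finset.sum_le_sum fun j _ => by
          rw [abs_mul]; exact mul_le_mul_of_nonneg_left (hp j) (abs_nonneg _))
    _ = (∑ j, |l j|) * L := by rw [Finset.sum_mul]
    _ ≤ R * L := mul_le_mul_of_nonneg_right hl hL

theorem continuous_margin (φ : Fin M → X → ℝ) (p : X × Label) : Continuous (margin φ p) := by
  unfold margin linComb; fun_prop

theorem l1Ball_mono {r R : ℝ} (h : r ≤ R) : l1Ball M r ⊆ l1Ball M R :=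
  fun _ hl => le_trans hl h

variable [MeasurableSpace X]

theorem measurable_margin {φ : Fin M → X → ℝ} (hφ : ∀ j, Measurable (φ j)) :
    Measurable (Function.uncurry (margin φ)) := by
  have h1 : Measurable fun q : (X × Label) × (Fin M → ℝ) => (q.1.2 : ℝ) :=
    measurable_subtype_coe.comp (measurable_snd.comp measurable_fst)
  have h2 : ∀ j, Measurable fun q : (X × Label) × (Fin M → ℝ) => q.2 j * φ j q.1.1 := fun j =>
    ((measurable_pi_apply j).comp measurable_snd).mul
      ((hφ j).comp (measurable_fst.comp measurable_fst))
  exact h1.neg.mul (Finset.measurable_sum _ fun j _ => h2 j)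

theorem ae_abs_le_of_eLpNorm_top_le {P : Measure (X × Label)} {φ : Fin M → X → ℝ} {L : ℝ}
    (hL : 0 ≤ L) (hφL : ∀ j, eLpNorm (φ j) ∞ P.fst ≤ ENNReal.ofReal L) :
    ∀ᵐ p ∂P, ∀ j, |φ j p.1| ≤ L := by
  refine ae_all_iff.2 fun j => ?_
  have h : ∀ᵐ x ∂P.fst, |φ j x| ≤ L := by
    filter_upwards [ae_le_eLpNormEssSup (f := φ j) (μ := P.fst)] with x hx
    have h1 := hx.trans ((eLpNorm_exponent_top (f := φ j) (μ := P.fst)).symm.le.trans (hφL j))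
    rw [Real.enorm_eq_ofReal_abs] at h1
    exact (ENNReal.ofReal_le_ofReal_iff hL).1 h1
  exact ae_of_ae_map measurable_fst.aemeasurable h

/-- The margin of the mirror averaging aggregate is the average of the posterior means of the
margins. -/
theorem margin_sparseMA {τ R β : ℝ} (hM : 0 < M) (hτ : 0 < τ) (hR : 2 * (M : ℝ) * τ ≤ R)
    (hβ : 0 < β) {φ : Fin M → X → ℝ} (hφ : ∀ j, Measurable (φ j)) {Φ : ℝ → ℝ}
    (hΦc : Continuous Φ) (hΦ0 : ∀ u, 0 ≤ Φ u) (z : Fin n → X × Label) (p : X × Label) :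
    -(p.2 : ℝ) * sparseMA Φ φ τ R β z p.1 = 1 / ((n : ℝ) + 1) * ∑ m ∈ Finset.range (n + 1),
      ∫ l, margin φ p l
        ∂(gibbs (sparsityPrior M τ R) β (fun z l => Φ (margin φ z l)) m z) := by
  have := isProbabilityMeasure_sparsityPrior hM hτ hR
  set π := sparsityPrior M τ R with hπ
  set q : X × Label → (Fin M → ℝ) → ℝ := fun z l => Φ (margin φ z l) with hqdef
  have hq : Measurable (Function.uncurry q) := hΦc.measurable.comp (measurable_margin hφ)
  have hq0 : ∀ z l, 0 ≤ q z l := fun z l => hΦ0 _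
  have hw : ∀ m l, expWeight (contrast Φ) (linComb φ) π β m z l
      = Real.exp (-(1 / β) * cumLoss q m z l) / ∫ l, Real.exp (-(1 / β) * cumLoss q m z l) ∂π :=
    fun m l => rfl
  have hint : ∀ m, Integrable (fun l =>
      expWeight (contrast Φ) (linComb φ) π β m z l * margin φ p l) π := fun m => by
    have := isProbabilityMeasure_gibbs (π := π) hβ hq hq0 m z
    obtain ⟨D, hD⟩ := (isCompact_l1Ball M R).exists_bound_of_continuousOn
      (continuous_margin φ p).continuousOn
    have h1 : Integrable (margin φ p) (gibbs π β q m z) :=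
      Integrable.of_bound (C := D) (continuous_margin φ p).aestronglyMeasurable
        ((gibbs_absolutelyContinuous π β q m z).ae_le (ae_mem_l1Ball.mono hD))
    have h2 := ((integrable_tilted_iff (integrable_exp_cumLoss (π := π) hβ hq hq0 m z) _).1
      h1).const_mul (∫ l, Real.exp (-(1 / β) * cumLoss q m z l) ∂π)⁻¹
    refine h2.congr (Filter.Eventually.of_forall fun l => ?_)
    simp only [hw, smul_eq_mul]
    ring
  calc -(p.2 : ℝ) * sparseMA Φ φ τ R β z p.1
      = ∫ l, 1 / ((n : ℝ) + 1) * ∑ m ∈ Finset.range (n + 1),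
          expWeight (contrast Φ) (linComb φ) π β m z l * margin φ p l ∂π := by
        rw [sparseMA, maAggregate, ← integral_const_mul]
        refine integral_congr_ae (Filter.Eventually.of_forall fun l => ?_)
        simp only [maWeight, margin, ← Finset.sum_mul]
        ring
    _ = _ := by
        rw [integral_const_mul, integral_finsetSum _ fun m _ => hint m]
        simp only [gibbs, integral_tilted, smul_eq_mul, hw]

theorem sum_integral_sq_fst {P : Measure (X × Label)} {φ : Fin M → X → ℝ}
    (hφ : ∀ j, Measurable (φ j)) :
    ∑ j, ∫ x, φ j x ^ 2 ∂P.fst = ∑ j, ∫ p, φ j p.1 ^ 2 ∂P :=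
  Finset.sum_congr rfl fun j _ =>
    integral_map measurable_fst.aemeasurable ((hφ j).pow_const 2).aestronglyMeasurable

end Dictionary

/-! ### Risk bounds for the sparse mirror averaging aggregate -/

section Risk

variable {X : Type*} [MeasurableSpace X] {M n : ℕ} {φ : Fin M → X → ℝ} {L R τ β : ℝ} {Φ : ℝ → ℝ}

theorem measurable_contrast_sparseMA (hM : 0 < M) (hτ : 0 < τ) (hR : 2 * (M : ℝ) * τ ≤ R)
    (hβ : 0 < β) (hφ : ∀ j, Measurable (φ j)) (hΦc : Continuous Φ) (hΦ0 : ∀ u, 0 ≤ Φ u) :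
    Measurable fun r : (Fin n → X × Label) × (X × Label) =>
      contrast Φ r.2 (sparseMA Φ φ τ R β r.1) := by
  have := isProbabilityMeasure_sparsityPrior hM hτ hR
  simp only [contrast, margin_sparseMA hM hτ hR hβ hφ hΦc hΦ0]
  exact hΦc.measurable.comp ((Finset.measurable_sum _ fun m _ =>
    measurable_integral_gibbs (q := fun z l => Φ (margin φ z l)) (measurable_margin hφ)
      (hΦc.measurable.comp (measurable_margin hφ)) m).const_mul _)

/-- Posterior means of margins stay in `[-R L, R L]`. The constant is uniform in the sample, which
also gives integrability of the risk over samples. -/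
theorem exists_contrast_sparseMA_le {P : Measure (X × Label)} (hM : 0 < M) (hτ : 0 < τ) (hR : 2 * (M : ℝ) * τ ≤ R)
    (hβ : 0 < β) (hφ : ∀ j, Measurable (φ j)) (hL : 0 ≤ L)
    (hφL : ∀ᵐ p ∂P, ∀ j, |φ j p.1| ≤ L) (hΦc : Continuous Φ) (hΦ0 : ∀ u, 0 ≤ Φ u) :
    ∃ D, ∀ z : Fin n → X × Label, ∀ᵐ p ∂P, ‖contrast Φ p (sparseMA Φ φ τ R β z)‖ ≤ D := by
  have := isProbabilityMeasure_sparsityPrior hM hτ hR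
  obtain ⟨D, hD⟩ : ∃ D, ∀ u ∈ Set.Icc (-(R * L)) (R * L), ‖Φ u‖ ≤ D :=
    isCompact_Icc.exists_bound_of_continuousOn hΦc.continuousOn
  refine ⟨D, fun z => hφL.mono fun p hp => hD _ (abs_le.1 ?_)⟩
  rw [margin_sparseMA hM hτ hR hβ hφ hΦc hΦ0]
  have hb : ∀ m ∈ Finset.range (n + 1), |∫ l, margin φ p l
      ∂(gibbs (sparsityPrior M τ R) β (fun z l => Φ (margin φ z l)) m z)| ≤ R * L := fun m _ => by
    have := isProbabilityMeasure_gibbs (π := sparsityPrior M τ R)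
      (q := fun z l => Φ (margin φ z l)) hβ
      (hΦc.measurable.comp (measurable_margin hφ)) (fun z l => hΦ0 (margin φ z l)) m z
    exact abs_integral_le_of_ae ((gibbs_absolutelyContinuous _ _ _ m z).ae_le
      (ae_mem_l1Ball.mono fun l hl => abs_margin_le hL hp hl))
  have hs := (Finset.abs_sum_le_sum_abs _ _).trans (Finset.sum_le_sum hb)
  rw [Finset.sum_const, Finset.card_range, nsmul_eq_mul] at hs
  rw [abs_mul, abs_of_pos (by positivity)]
  calc _ ≤ 1 / ((n : ℝ) + 1) * (((n + 1 : ℕ) : ℝ) * (R * L)) := by gcongr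
    _ = R * L := by push_cast; field_simp

variable {P : Measure (X × Label)} [IsProbabilityMeasure P]

theorem integrable_contrast_sparseMA (hM : 0 < M) (hτ : 0 < τ) (hR : 2 * (M : ℝ) * τ ≤ R)
    (hβ : 0 < β) (hφ : ∀ j, Measurable (φ j)) (hL : 0 ≤ L)
    (hφL : ∀ᵐ p ∂P, ∀ j, |φ j p.1| ≤ L) (hΦc : Continuous Φ) (hΦ0 : ∀ u, 0 ≤ Φ u)
    (z : Fin n → X × Label) :
    Integrable (fun p : X × Label => contrast Φ p (sparseMA Φ φ τ R β z)) P := by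
  obtain ⟨D, hD⟩ := exists_contrast_sparseMA_le (n := n) hM hτ hR hβ hφ hL hφL hΦc hΦ0
  exact Integrable.of_bound (C := D) ((measurable_contrast_sparseMA hM hτ hR hβ hφ hΦc hΦ0).comp
    measurable_prodMk_left).aestronglyMeasurable (hD z)

theorem integrable_phiRisk_sparseMA (hM : 0 < M) (hτ : 0 < τ) (hR : 2 * (M : ℝ) * τ ≤ R)
    (hβ : 0 < β) (hφ : ∀ j, Measurable (φ j)) (hL : 0 ≤ L)
    (hφL : ∀ᵐ p ∂P, ∀ j, |φ j p.1| ≤ L) (hΦc : Continuous Φ) (hΦ0 : ∀ u, 0 ≤ Φ u) :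
    Integrable (fun z : Fin n → X × Label => phiRisk Φ P (sparseMA Φ φ τ R β z))
      (Measure.pi fun _ => P) := by
  obtain ⟨D, hD⟩ := exists_contrast_sparseMA_le (n := n) hM hτ hR hβ hφ hL hφL hΦc hΦ0
  refine Integrable.of_bound (C := D) (StronglyMeasurable.integral_prod_right' (ν := P)
    (measurable_contrast_sparseMA hM hτ hR hβ hφ hΦc hΦ0).stronglyMeasurable).aestronglyMeasurable
    (Filter.Eventually.of_forall fun z => abs_integral_le_of_ae (hD z))

/-- Dominated convergence on the compact ball; this continuity is what makes the minimum attained.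
-/
theorem continuousOn_phiRisk_linComb (hφ : ∀ j, Measurable (φ j)) (hL : 0 ≤ L)
    (hφL : ∀ᵐ p ∂P, ∀ j, |φ j p.1| ≤ L) (hΦc : Continuous Φ) (R : ℝ) :
    ContinuousOn (fun l : Fin M → ℝ => phiRisk Φ P (linComb φ l)) (l1Ball M R) := by
  obtain ⟨D, hD⟩ : ∃ D, ∀ u ∈ Set.Icc (-(R * L)) (R * L), ‖Φ u‖ ≤ D :=
    isCompact_Icc.exists_bound_of_continuousOn hΦc.continuousOn
  refine continuousOn_of_dominated (bound := fun _ => D)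
    (F := fun l p => Φ (margin φ p l)) (fun l _ => ?_) (fun l hl => ?_) (integrable_const _) ?_
  · exact (hΦc.measurable.comp ((measurable_margin hφ).comp
      measurable_prodMk_right)).aestronglyMeasurable
  · exact hφL.mono fun p hp => hD _ (abs_le.1 (abs_margin_le hL hp hl))
  · exact Filter.Eventually.of_forall fun p => (hΦc.comp (continuous_margin φ p)).continuousOn

/-- The penalized risk attains its minimum over an `ℓ¹`-ball. -/
theorem exists_isLeast_penalized (hφ : ∀ j, Measurable (φ j)) (hL : 0 ≤ L)
    (hφL : ∀ᵐ p ∂P, ∀ j, |φ j p.1| ≤ L) (hΦc : Continuous Φ) {r : ℝ} (hr : 0 ≤ r)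
    (hτ : 0 < τ) (a c : ℝ) :
    ∃ m, IsLeast ((fun l : Fin M → ℝ => (phiRisk Φ P (linComb φ l) - c)
      + a * ∑ j, Real.log (1 + τ⁻¹ * |l j|)) '' l1Ball M r) m := by
  refine (((isCompact_l1Ball M r).image_of_continuousOn ?_)).exists_isLeast
    ⟨_, Set.mem_image_of_mem _ (show (0 : Fin M → ℝ) ∈ l1Ball M r by simpa [l1Ball] using hr)⟩
  refine ((continuousOn_phiRisk_linComb hφ hL hφL hΦc r).sub continuousOn_const).add
    (Continuous.continuousOn (continuous_const.mul (continuous_finsetSum _ fun j _ => ?_)))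
  refine Continuous.log (by fun_prop) fun l => ?_
  positivity

theorem integral_phiRisk_sparseMA_le (hM : 0 < M) (hτ : 0 < τ) (hβ : 0 < β)
    (hφ : ∀ j, Measurable (φ j)) (hL : 0 ≤ L)
    (hφL : ∀ᵐ p ∂P, ∀ j, |φ j p.1| ≤ L) (hΦ_nonneg : ∀ u, 0 ≤ Φ u)
    (hΦ_conv : ConvexOn ℝ Set.univ Φ) (hΦ_smooth : ContDiff ℝ 2 Φ)
    (hβΦ : betaPhi Φ (R * L) ≤ ENNReal.ofReal β) {l₀ : Fin M → ℝ}
    (hl₀ : l₀ ∈ l1Ball M (R - 2 * (M : ℝ) * τ)) :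
    ∫ z : Fin n → X × Label, phiRisk Φ P (sparseMA Φ φ τ R β z) ∂(Measure.pi fun _ => P)
      ≤ phiRisk Φ P (linComb φ l₀) + 4 * β / ((n : ℝ) + 1) * ∑ j, Real.log (1 + τ⁻¹ * |l₀ j|)
        + cPhi Φ (R * L) * τ ^ 2 * (∑ j, ∫ x, φ j x ^ 2 ∂P.fst) + β / ((n : ℝ) + 1) := by
  have hrad : 0 ≤ R - 2 * (M : ℝ) * τ :=
    (Finset.sum_nonneg fun _ _ => abs_nonneg _).trans (show ∑ j, |l₀ j| ≤ _ from hl₀)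
  have hR : 2 * (M : ℝ) * τ ≤ R := by linarith
  have hR0 : 0 ≤ 2 * (M : ℝ) * τ := by positivity
  have hΦc := hΦ_smooth.continuous
  have hprior := isProbabilityMeasure_sparsityPrior hM hτ hR
  have hprior₀ := isProbabilityMeasure_sparsityPrior hM hτ (le_refl (2 * (M : ℝ) * τ))
  set π := sparsityPrior M τ R with hπ
  set π₀ := sparsityPrior M τ (2 * (M : ℝ) * τ) with hπ₀
  have hadd : Measurable fun l : Fin M → ℝ => l₀ + l := measurable_const_add l₀
  set ρ := π₀.map (fun l => l₀ + l) with hρ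
  have hρprob : IsProbabilityMeasure ρ := Measure.isProbabilityMeasure_map hadd.aemeasurable
  set K := ∏ j, (1 + τ⁻¹ * |l₀ j|) ^ 4 with hK
  have hK0 : 0 < K := Finset.prod_pos fun j _ => by positivity
  -- Only `log 2 ≤ 1` is lost here; this 1 becomes the remainder `β / (n + 1)`.
  have hlogK : Real.log (2 * K) ≤ 1 + 4 * ∑ j, Real.log (1 + τ⁻¹ * |l₀ j|) := by
    rw [Real.log_mul two_ne_zero hK0.ne', hK, Real.log_prod fun j _ => by positivity,
      Finset.mul_sum]
    simp only [Real.log_pow, Nat.cast_ofNat]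
    linarith [Real.log_two_lt_d9]
  have hMA := integral_loss_mirrorAveraging_le (n := n) (P := P) (π := π) (ρ := ρ) hβ hΦc
    hΦ_nonneg hΦ_conv (concaveOn_exp_neg_of_betaPhi_le hΦ_smooth hΦ_conv hβ hβΦ)
    (measurable_margin hφ)
    (hφL.mono fun p hp => ae_mem_l1Ball.mono fun l hl => abs_margin_le hL hp hl)
    (by positivity : 0 < 2 * K) (map_sparsityPrior_le hM hτ hl₀)
  simp only [← margin_sparseMA hM hτ hR hβ hφ hΦc hΦ_nonneg, hπ] at hMA
  -- the risk of the translated posterior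
  set S := sSup (iteratedDeriv 2 Φ '' Set.Icc (-(R * L)) (R * L)) with hS
  have hSle : ∀ u ∈ Set.Icc (-(R * L)) (R * L), iteratedDeriv 2 Φ u ≤ S := fun u hu =>
    le_csSup (isCompact_Icc.bddAbove_image
      (hΦ_smooth.continuous_iteratedDeriv 2 le_rfl).continuousOn) (Set.mem_image_of_mem _ hu)
  have hRL : 0 ≤ R * L := mul_nonneg (hR0.trans hR) hL
  have hS0 : 0 ≤ S := (iteratedDeriv_two_nonneg hΦ_smooth hΦ_conv 0).trans
    (hSle 0 ⟨by linarith, hRL⟩)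
  have hpt : ∀ᵐ p ∂P, ∫ l, Φ (margin φ p l) ∂ρ
      ≤ Φ (margin φ p l₀) + S * τ ^ 2 * ∑ j, φ j p.1 ^ 2 := hφL.mono fun p hp => by
    rw [hρ, integral_map hadd.aemeasurable (f := fun l => Φ (margin φ p l))
      (hΦc.comp (continuous_margin φ p)).aestronglyMeasurable]
    simp only [margin_add]
    refine (integral_comp_linear_sparsityPrior_le hM hτ le_rfl hΦ_smooth hS0 hSle _ _
      fun l hl => ?_).trans_eq ?_
    · rw [← margin_add]
      refine abs_margin_le hL hp ?_
      have h1 : ∑ j, |l₀ j| ≤ R - 2 * (M : ℝ) * τ := hl₀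
      have h2 : ∑ j, |l j| ≤ 2 * (M : ℝ) * τ := hl
      have h3 : ∑ j, |(l₀ + l) j| ≤ ∑ j, (|l₀ j| + |l j|) :=
        Finset.sum_le_sum fun j _ => abs_add_le _ _
      rw [Finset.sum_add_distrib] at h3
      exact h3.trans (by linarith)
    -- The perturbation has coefficients `v_j = -y φ_j(x)`, and the label disappears on squaring.
    · have hy : (-(p.2 : ℝ)) ^ 2 = 1 := by rw [neg_sq, ← sq_abs, abs_label, one_pow]
      simp only [mul_pow, hy, one_mul]
  have hsq : ∀ j, Integrable (fun p : X × Label => φ j p.1 ^ 2) P := fun j => by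
    refine Integrable.of_bound (C := L ^ 2)
      (((hφ j).comp measurable_fst).pow_const 2).aestronglyMeasurable (hφL.mono fun p hp => ?_)
    rw [Real.norm_eq_abs, abs_pow]
    exact pow_le_pow_left₀ (abs_nonneg _) (hp j) 2
  have hl₀i : Integrable (fun p => Φ (margin φ p l₀)) P := by
    obtain ⟨D, hD⟩ : ∃ D, ∀ u ∈ Set.Icc (-(R * L)) (R * L), ‖Φ u‖ ≤ D :=
      isCompact_Icc.exists_bound_of_continuousOn hΦc.continuousOn
    exact Integrable.of_bound (C := D) (hΦc.measurable.comp ((measurable_margin hφ).comp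
      measurable_prodMk_right)).aestronglyMeasurable (hφL.mono fun p hp =>
        hD _ (abs_le.1 (abs_margin_le hL hp (l1Ball_mono (by linarith) hl₀))))
  have hsqs := (integrable_finsetSum Finset.univ fun j _ => hsq j).const_mul (S * τ ^ 2)
  have hcomp : ∫ p, ∫ l, Φ (margin φ p l) ∂ρ ∂P
      ≤ phiRisk Φ P (linComb φ l₀) + S * τ ^ 2 * ∑ j, ∫ x, φ j x ^ 2 ∂P.fst := by
    refine (integral_mono_of_nonneg (Filter.Eventually.of_forall fun p =>
      integral_nonneg fun l => hΦ_nonneg _) (hl₀i.add hsqs) hpt).trans_eq ?_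
    simp only [Pi.add_apply]
    rw [integral_add hl₀i hsqs, integral_const_mul, integral_finsetSum _ fun j _ => hsq j,
      sum_integral_sq_fst hφ]
    rfl
  -- The argument gives the constant `S`; the stated constant is `4 S`.
  have hbias : S * τ ^ 2 * (∑ j, ∫ x, φ j x ^ 2 ∂P.fst)
      ≤ cPhi Φ (R * L) * τ ^ 2 * (∑ j, ∫ x, φ j x ^ 2 ∂P.fst) := by
    have h0 : 0 ≤ ∑ j, ∫ x, φ j x ^ 2 ∂P.fst :=
      Finset.sum_nonneg fun j _ => integral_nonneg fun x => sq_nonneg _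
    have : S ≤ cPhi Φ (R * L) := by rw [cPhi, ← hS]; linarith
    gcongr
  have hent : β / ((n : ℝ) + 1) * Real.log (2 * K)
      ≤ β / ((n : ℝ) + 1) + 4 * β / ((n : ℝ) + 1) * ∑ j, Real.log (1 + τ⁻¹ * |l₀ j|) :=
    (mul_le_mul_of_nonneg_left hlogK (by positivity)).trans_eq (by ring)
  change ∫ z : Fin n → X × Label, phiRisk Φ P (sparseMA Φ φ τ R β z) ∂(Measure.pi fun _ => P)
    ≤ _ at hMA
  linarith

/-- The oracle inequality for the risk recentred by an arbitrary constant. -/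
theorem oracle_inequality (n : ℕ) (hM : 0 < M) (hτ : 0 < τ) (hβ : 0 < β)
    (hR : 2 * (M : ℝ) * τ ≤ R) (hφ : ∀ j, Measurable (φ j)) (hL : 0 ≤ L)
    (hφL : ∀ᵐ p ∂P, ∀ j, |φ j p.1| ≤ L) (hΦ_nonneg : ∀ u, 0 ≤ Φ u)
    (hΦ_conv : ConvexOn ℝ Set.univ Φ) (hΦ_smooth : ContDiff ℝ 2 Φ)
    (hβΦ : betaPhi Φ (R * L) ≤ ENNReal.ofReal β) (c : ℝ) :
    Integrable (fun z : Fin n → X × Label => phiRisk Φ P (sparseMA Φ φ τ R β z) - c)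
        (Measure.pi fun _ : Fin n => P) ∧
      ∃ m : ℝ,
        IsLeast ((fun l : Fin M → ℝ => (phiRisk Φ P (linComb φ l) - c)
            + 4 * β / ((n : ℝ) + 1) * ∑ j, Real.log (1 + τ⁻¹ * |l j|))
          '' l1Ball M (R - 2 * (M : ℝ) * τ)) m ∧
        ∫ z : Fin n → X × Label, (phiRisk Φ P (sparseMA Φ φ τ R β z) - c)
            ∂(Measure.pi fun _ : Fin n => P)
          ≤ m + cPhi Φ (R * L) * τ ^ 2 * (∑ j, ∫ x, φ j x ^ 2 ∂P.fst) + β / ((n : ℝ) + 1) := by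
  have hΦc := hΦ_smooth.continuous
  have hi := integrable_phiRisk_sparseMA (n := n) hM hτ hR hβ hφ hL hφL hΦc hΦ_nonneg
  refine ⟨hi.sub (integrable_const c), ?_⟩
  obtain ⟨m, hm⟩ := exists_isLeast_penalized hφ hL hφL hΦc (sub_nonneg.2 hR) hτ
    (4 * β / ((n : ℝ) + 1)) c
  refine ⟨m, hm, ?_⟩
  -- The risk bound holds at every point of the smaller ball, so it can be applied at a minimizer.
  obtain ⟨l₀, hl₀, rfl⟩ := hm.1
  have h := integral_phiRisk_sparseMA_le (n := n) hM hτ hβ hφ hL hφL hΦ_nonneg hΦ_conv hΦ_smooth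
    hβΦ hl₀
  rw [integral_sub hi (integrable_const c)]
  simp only [integral_const, probReal_univ, smul_eq_mul, one_mul]
  linarith

end Risk

end SparsityMA

open SparsityMA in
theorem proposition4 {X : Type*} [MeasurableSpace X]
    (P : Measure (X × Label)) [IsProbabilityMeasure P]
    (n M : ℕ) (hM : 2 ≤ M)
    (φ : Fin M → X → ℝ) (hφ : ∀ j, Measurable (φ j))
    (L R τ β : ℝ) (hL : 0 < L) (hτ : 0 < τ) (hβ : 0 < β) (hR : 2 * (M : ℝ) * τ ≤ R)
    (hφL : ∀ j, eLpNorm (φ j) ∞ P.fst ≤ ENNReal.ofReal L)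
    (Φ : ℝ → ℝ) (hΦ_nonneg : ∀ u, 0 ≤ Φ u) (hΦ_conv : ConvexOn ℝ Set.univ Φ)
    (hΦ_smooth : ContDiff ℝ 2 Φ)
    (hβΦ : betaPhi Φ (R * L) ≤ ENNReal.ofReal β) :
    -- for every sample, the risk of the aggregate is a convergent integral
    (∀ z : Fin n → X × Label,
      Integrable (fun p : X × Label => contrast Φ p (sparseMA Φ φ τ R β z)) P) ∧
    -- the oracle inequality for the excess risk with respect to an optimal classifier
    (∀ f : X → ℝ, IsPhiOptimal Φ P f →
      Integrable (fun z : Fin n → X × Label => excessPhiRisk Φ P (sparseMA Φ φ τ R β z) f)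
        (Measure.pi fun _ : Fin n => P) ∧
      ∃ m : ℝ,
        IsLeast ((fun l : Fin M → ℝ => excessPhiRisk Φ P (linComb φ l) f
            + 4 * β / ((n : ℝ) + 1) * ∑ j, Real.log (1 + τ⁻¹ * |l j|))
          '' l1Ball M (R - 2 * (M : ℝ) * τ)) m ∧
        ∫ z : Fin n → X × Label, excessPhiRisk Φ P (sparseMA Φ φ τ R β z) f
            ∂(Measure.pi fun _ : Fin n => P)
          ≤ m + cPhi Φ (R * L) * τ ^ 2 * (∑ j, ∫ x, φ j x ^ 2 ∂P.fst) + β / ((n : ℝ) + 1)) ∧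
    -- the same with the infimum of the risk, whether or not an optimal classifier exists
    (Integrable (fun z : Fin n → X × Label =>
        phiRisk Φ P (sparseMA Φ φ τ R β z) - infPhiRisk Φ P)
        (Measure.pi fun _ : Fin n => P) ∧
      ∃ m : ℝ,
        IsLeast ((fun l : Fin M → ℝ => (phiRisk Φ P (linComb φ l) - infPhiRisk Φ P)
            + 4 * β / ((n : ℝ) + 1) * ∑ j, Real.log (1 + τ⁻¹ * |l j|))
          '' l1Ball M (R - 2 * (M : ℝ) * τ)) m ∧
        ∫ z : Fin n → X × Label, (phiRisk Φ P (sparseMA Φ φ τ R β z) - infPhiRisk Φ P)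
            ∂(Measure.pi fun _ : Fin n => P)
          ≤ m + cPhi Φ (R * L) * τ ^ 2 * (∑ j, ∫ x, φ j x ^ 2 ∂P.fst) + β / ((n : ℝ) + 1)) := by
  have hM' : 0 < M := by omega
  have hφL' := ae_abs_le_of_eLpNorm_top_le hL.le hφL
  have h := oracle_inequality n hM' hτ hβ hR hφ hL.le hφL' hΦ_nonneg hΦ_conv hΦ_smooth hβΦ
  exact ⟨integrable_contrast_sparseMA hM' hτ hR hβ hφ hL.le hφL' hΦ_smooth.continuous hΦ_nonneg,
    fun f _ => h (phiRisk Φ P f), h (infPhiRisk Φ P)⟩
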